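/- Let $Q$ be a smooth (finite-dimensional, Hausdorff, boundaryless) manifold and let $\tau_A:A\to Q$ be a Lie algebroid with bracket $[\![\cdot,\cdot]\!]_A$ on $\Gamma(A)$ and anchor $\rho_A:A\to TQ$. Let $\mathcal G$ be a (positive definite) bundle metric on $A$, let $V\in C^\infty(Q)$, and let $L(a)=\tfrac12\mathcal G(a,a)-V(\tau_A(a))$ with energy $E_L=\Delta(L)-L$, $\Delta$ the Liouville vector field of $A$, so that $E_L(a)=\tfrac12\mathcal G(a,a)+V(\tau_A(a))$. Let $D\subseteq A$ be a vector subbundle with projection $\tau_D$, inclusion $i_D:D\to A$ and $\mathcal G$-orthogonal projector $P:A\to D$, let $i_D^*:A^*\to D^*$ and $P^*:D^*\to A^*$ be the dual maps, and let $\#_{\mathcal G_D}:D^*\to D$ be the inverse of the isomorphism $D\to D^*$ induced by $\mathcal G_D=\mathcal G|_D$. Dynamics. Let $\nabla^{\mathcal G}$ be the Levi-Civita connection of $\mathcal G$ on $A$, determined by $$2\mathcal G(\nabla^{\mathcal G}_XY,Z)=\rho_A(X)(\mathcal G(Y,Z))+\rho_A(Y)(\mathcal G(X,Z))-\rho_A(Z)(\mathcal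 G(X,Y))+\mathcal G(X,[\![Z,Y]\!]_A)+\mathcal G(Y,[\![Z,X]\!]_A)-\mathcal G(Z,[\![Y,X]\!]_A),$$ and let $\xi_{\mathcal G}$ be its geodesic flow, the vector field on $A$ with $\xi_{\mathcal G}(X(q))=T_qX(\rho_A(X(q)))-(\nabla^{\mathcal G}_XX)^{\mathbf v}(X(q))$ for $X\in\Gamma(A)$ and $q\in Q$, where $^{\mathbf v}$ is the vertical lift. Let $\mathrm{grad}_{\mathcal G}V\in\Gamma(A)$ be given by $\mathcal G(\mathrm{grad}_{\mathcal G}V,X)=\rho_A(X)(V)$, and put $\xi_L=\xi_{\mathcal G}-(\mathrm{grad}_{\mathcal G}V)^{\mathbf v}$ and $\xi_{(L,D)}=TP\circ\xi_L\circ i_D\in\mathfrak X(D)$. The solutions of the Lagrange–d'Alembert equations for $(L,D)$ are the integral curves of $\xi_{(L,D)}$ in $D$. For a section $\alpha$ of $D^*$ put $\xi_{(L,D)\alpha}(q)=(T\tau_D)\big(\xi_{(L,D)}(\#_{\mathcal G_D}(\alpha(q)))\big)$, a vector field on $Q$. Nonholonomic bracket. Let $\{\cdot,\cdot\}_{A^*}$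 be the linear Poisson bracket on $A^*$ induced by the Lie algebroid structure, that is, the one with $\{\hat X,\hat Y\}_{A^*}=-\widehat{[\![X,Y]\!]_A}$, $\{f\circ\tau_{A^*},\hat X\}_{A^*}=\rho_A(X)(f)\circ\tau_{A^*}$ and $\{f\circ\tau_{A^*},g\circ\tau_{A^*}\}_{A^*}=0$, where $\hat X$ is the fibrewise linear function defined by the section $X$. The nonholonomic bracket on $D^*$ is $\{\varphi,\psi\}_{D^*}=\{\varphi\circ i_D^*,\psi\circ i_D^*\}_{A^*}\circ P^*$. It determines a skew-symmetric algebroid structure on $D$ by $\widehat{[\![X,Y]\!]_D}=-\{\hat X,\hat Y\}_{D^*}$ and $\rho_D(X)(f)\circ\tau_{D^*}=\{f\circ\tau_{D^*},\hat X\}_{D^*}$, with almost differential $(d^Df)(X)=\rho_D(X)(f)$ and $(d^D\alpha)(X,Y)=\rho_D(X)(\alpha(Y))-\rho_D(Y)(\alpha(X))-\alpha([\![X,Y]\!]_D)$ for $f\in C^\infty(Q)$, $\alpha\in\Gamma(D^*)$, $X,Y\in\Gamma(D)$. Put $H^0(d^D)=\{f\in C^\infty(Q): d^Df=0\}$. The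 algebroid $D$ is called completely nonholonomic if, for every $q\in Q$, the values at $q$ of the elements of the smallest Lie algebra of vector fields on $Q$ that contains all smooth vector fields with values in $\rho_D(D)$ fill $T_qQ$. Statement. Let $\alpha\in\Gamma(D^*)$ satisfy $d^D\alpha=0$. Then the following are equivalent: (i) for every integral curve $c:I\to Q$ of $\xi_{(L,D)\alpha}$ on an open interval $I$, the curve $\#_{\mathcal G_D}\circ\alpha\circ c:I\to D$ is a solution of the Lagrange–d'Alembert equations for $(L,D)$; (ii) $d^D\big((E_L)|_D\circ\#_{\mathcal G_D}\circ\alpha\big)=0$. If, in addition, $H^0(d^D)\cong\mathbb R$ as real vector spaces, or $D$ is completely nonholonomic and $Q$ is connected, then (i) and (ii) are also equivalent to (iii) the function $(E_L)|_D\circ\#_{\mathcal G_D}\circ\alpha$ is constant on $Q$. -/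

import Mathlib

open Bundle Manifold Module Filter Topology
open scoped ContDiff InnerProductSpace

noncomputable section

namespace NonholonomicHJ

/-- Transport of a tangent vector along an equality of base points. -/
def tangentCast {E H M : Type*} [NormedAddCommGroup E] [NormedSpace ℝ E] [TopologicalSpace H]
    {I : ModelWithCorners ℝ E H} [TopologicalSpace M] [ChartedSpace H M] {x y : M} (h : x = y)
    (v : TangentSpace I x) : TangentSpace I y :=
  h ▸ v

section LieAlgebroid

variable (E : Type*) [NormedAddCommGroup E] [NormedSpace ℝ E]
  {Q : Type*} [TopologicalSpace Q] [ChartedSpace E Q]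
  (F : Type*) [NormedAddCommGroup F] [NormedSpace ℝ F]
  (A : Q → Type*) [TopologicalSpace (TotalSpace F A)] [∀ q, AddCommGroup (A q)]
  [∀ q, Module ℝ (A q)] [∀ q, TopologicalSpace (A q)] [FiberBundle F A] [VectorBundle ℝ F A]

/-- The space `Γ(A)` of smooth sections of the vector bundle `A → Q`. -/
abbrev Sec : Type _ := ContMDiffSection 𝓘(ℝ, E) F ∞ A

/-- A Lie algebroid structure on the vector bundle `A → Q`: an `ℝ`-bilinear bracket on `Γ(A)` and
a smooth vector bundle morphism `ρ : A → TQ` over the identity of `Q`, such that the bracket is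
skew-symmetric, satisfies the Leibniz rule `[X, fY] = f[X, Y] + ρ(X)(f) Y` and the Jacobi
identity. -/
structure LieAlgebroid [IsManifold 𝓘(ℝ, E) ∞ Q] where
  bracket : Sec E F A →ₗ[ℝ] Sec E F A →ₗ[ℝ] Sec E F A
  anchor : ∀ q, A q →ₗ[ℝ] TangentSpace 𝓘(ℝ, E) q
  contMDiff_anchor : ContMDiff (𝓘(ℝ, E).prod 𝓘(ℝ, F)) 𝓘(ℝ, E).tangent ∞
    (fun a : TotalSpace F A => (⟨a.1, anchor a.1 a.2⟩ : TangentBundle 𝓘(ℝ, E) Q))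
  skew : ∀ X Y, bracket X Y = -bracket Y X
  leibniz : ∀ (X Y fY : Sec E F A) (f : Q → ℝ), ContMDiff 𝓘(ℝ, E) 𝓘(ℝ, ℝ) ∞ f →
    (∀ q, fY q = f q • Y q) →
    ∀ q, bracket X fY q = f q • bracket X Y q + mvfderiv 𝓘(ℝ, E) f q (anchor q (X q)) • Y q
  jacobi : ∀ X Y Z,
    bracket X (bracket Y Z) + bracket Y (bracket Z X) + bracket Z (bracket X Y) = 0

variable {A}

/-- Every vector `a ∈ A_q` is the value of a smooth global section which near `q` has constant
components in the trivialization at `q`. -/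
theorem exists_sec [FiniteDimensional ℝ E] [IsManifold 𝓘(ℝ, E) ∞ Q] [T2Space Q]
    [ContMDiffVectorBundle ∞ F A 𝓘(ℝ, E)] {q : Q} (a : A q) :
    ∃ X : Sec E F A, ∀ᶠ q' in 𝓝 q, X q' = FiberBundle.extend F a q' := by
  obtain ⟨s, hs, hsm⟩ := FiberBundle.exists_contMDiffOn_extend (k := ∞) 𝓘(ℝ, E) F a
  obtain ⟨u, hus, hu, hqu⟩ := mem_nhds_iff.1 hs
  obtain ⟨f, -, hf⟩ :=
    (SmoothBumpFunction.nhds_basis_tsupport (I := 𝓘(ℝ, E)) q).mem_iff.1 (hu.mem_nhds hqu)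
  refine ⟨⟨_, ContMDiffOn.smul_section_of_tsupport (ψ := f) f.contMDiff.contMDiffOn hu hf
    (hsm.mono hus)⟩, ?_⟩
  filter_upwards [f.eventuallyEq_one] with q' hq'
  simp [hq']

/-- A smooth global section through `a`, constant near the base point in the trivialization
there. -/
def secThrough [FiniteDimensional ℝ E] [IsManifold 𝓘(ℝ, E) ∞ Q] [T2Space Q]
    [ContMDiffVectorBundle ∞ F A 𝓘(ℝ, E)] {q : Q} (a : A q) : Sec E F A :=
  (exists_sec E F a).choose

theorem secThrough_apply [FiniteDimensional ℝ E] [IsManifold 𝓘(ℝ, E) ∞ Q] [T2Space Q]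
    [ContMDiffVectorBundle ∞ F A 𝓘(ℝ, E)] {q : Q} (a : A q) : secThrough E F a q = a :=
  (exists_sec E F a).choose_spec.self_of_nhds.trans (FiberBundle.extend_apply_self F a)

/-- The total space of the dual of a family of vector spaces over `Q`. -/
abbrev DualTot {Q : Type*} (B : Q → Type*) [∀ q, AddCommGroup (B q)] [∀ q, Module ℝ (B q)] :=
  Σ q, Dual ℝ (B q)

/-- For `φ : A* → ℝ` and `μ ∈ A*_q`, the vector `(∂φ/∂p_i)(μ) b_i ∈ A_q`, that is, the derivative
of `φ` along the fibre, seen in `A_q ≅ A_q**`. -/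
def fibreDeriv [∀ q, FiniteDimensional ℝ (A q)] (φ : DualTot A → ℝ) (μ : DualTot A) : A μ.1 :=
  ∑ i, deriv (fun t : ℝ => φ ⟨μ.1, μ.2 + t • (finBasis ℝ (A μ.1)).coord i⟩) 0 •
    finBasis ℝ (A μ.1) i

/-- The local section of `A*` through `μ ∈ A*_q` with constant momenta in the trivialization of
`A` at `q`. -/
def constMomentum (μ : DualTot A) (q' : Q) : DualTot A :=
  ⟨q', μ.2 ∘ₗ
    ((trivializationAt F A μ.1).symmL ℝ μ.1).toLinearMap ∘ₗ
    ((trivializationAt F A μ.1).continuousLinearMapAt ℝ q').toLinearMap⟩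

end LieAlgebroid

variable {E : Type*} [NormedAddCommGroup E] [NormedSpace ℝ E] [FiniteDimensional ℝ E]
  {Q : Type*} [TopologicalSpace Q] [ChartedSpace E Q] [IsManifold 𝓘(ℝ, E) ∞ Q] [T2Space Q]
  {F : Type*} [NormedAddCommGroup F] [NormedSpace ℝ F]
  {A : Q → Type*} [TopologicalSpace (TotalSpace F A)] [∀ q, NormedAddCommGroup (A q)]
  [∀ q, InnerProductSpace ℝ (A q)] [∀ q, FiniteDimensional ℝ (A q)]
  [FiberBundle F A] [VectorBundle ℝ F A] [ContMDiffVectorBundle ∞ F A 𝓘(ℝ, E)]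

/-- The linear Poisson bracket on `A*` induced by the Lie algebroid structure. In the local
coordinates `(q^j, p_a)` given by a local frame `(X_a)` of `A` it reads
`{φ, ψ} = ρ^j_a (∂φ/∂q^j ∂ψ/∂p_a - ∂φ/∂p_a ∂ψ/∂q^j) - C_{ab}^c p_c ∂φ/∂p_a ∂ψ/∂p_b`;
here the frame at `μ ∈ A*_q` is that of the trivialization of `A` at `q`. -/
def poissonBracket (S : LieAlgebroid E F A) (φ ψ : DualTot A → ℝ) (μ : DualTot A) : ℝ :=
  mvfderiv 𝓘(ℝ, E) (fun q' => φ (constMomentum F μ q')) μ.1 (S.anchor μ.1 (fibreDeriv ψ μ))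
  - mvfderiv 𝓘(ℝ, E) (fun q' => ψ (constMomentum F μ q')) μ.1 (S.anchor μ.1 (fibreDeriv φ μ))
  - μ.2 (S.bracket (secThrough E F (fibreDeriv φ μ)) (secThrough E F (fibreDeriv ψ μ)) μ.1)

section Unconstrained

/-- Right-hand side of the Koszul formula for the bundle metric of `A`. -/
def koszul (S : LieAlgebroid E F A) (X Y Z : Sec E F A) (q : Q) : ℝ :=
  mvfderiv 𝓘(ℝ, E) (fun q' => ⟪Y q', Z q'⟫_ℝ) q (S.anchor q (X q))
  + mvfderiv 𝓘(ℝ, E) (fun q' => ⟪X q', Z q'⟫_ℝ) q (S.anchor q (Y q))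
  - mvfderiv 𝓘(ℝ, E) (fun q' => ⟪X q', Y q'⟫_ℝ) q (S.anchor q (Z q))
  + ⟪X q, S.bracket Z Y q⟫_ℝ + ⟪Y q, S.bracket Z X q⟫_ℝ - ⟪Z q, S.bracket Y X q⟫_ℝ

/-- The Levi-Civita connection `∇_X Y`, determined by the Koszul formula
`2 G(∇_X Y, Z) = koszul X Y Z` for all `Z ∈ Γ(A)`. -/
def leviCivita (S : LieAlgebroid E F A) (X Y : Sec E F A) (q : Q) : A q :=
  Classical.epsilon fun w : A q => ∀ Z : Sec E F A, 2 * ⟪w, Z q⟫_ℝ = koszul S X Y Z q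

variable (E F) in
/-- The vertical lift of `w ∈ A_q` to the point `a ∈ A_q`. -/
def vlift (a : TotalSpace F A) (w : A a.1) : TangentSpace (𝓘(ℝ, E).prod 𝓘(ℝ, F)) a :=
  tangentCast (show (⟨a.1, a.2 + (0 : ℝ) • w⟩ : TotalSpace F A) = a by simp)
    (mfderiv 𝓘(ℝ, ℝ) (𝓘(ℝ, E).prod 𝓘(ℝ, F))
      (fun t : ℝ => (⟨a.1, a.2 + t • w⟩ : TotalSpace F A)) 0 (1 : ℝ))

/-- The geodesic flow `ξ_G`, the vector field on `A` whose integral curves are the geodesics of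
the Levi-Civita connection: `ξ_G(a) = T_qX(ρ(a)) - (∇_X X)(q)^v` for a section `X` with
`X(q) = a`; the result does not depend on `X`. -/
def geodesicFlow (S : LieAlgebroid E F A) (a : TotalSpace F A) :
    TangentSpace (𝓘(ℝ, E).prod 𝓘(ℝ, F)) a :=
  tangentCast
    (show (⟨a.1, secThrough E F a.2 a.1⟩ : TotalSpace F A) = a by rw [secThrough_apply])
    (mfderiv 𝓘(ℝ, E) (𝓘(ℝ, E).prod 𝓘(ℝ, F))
      (fun q' => (⟨q', secThrough E F a.2 q'⟩ : TotalSpace F A)) a.1 (S.anchor a.1 a.2))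
  - vlift E F a (leviCivita S (secThrough E F a.2) (secThrough E F a.2) a.1)

/-- The gradient of `V`: `G(grad V, X) = ρ(X)(V)`. -/
def grad (S : LieAlgebroid E F A) (V : Q → ℝ) (q : Q) : A q :=
  (InnerProductSpace.toDual ℝ (A q)).symm
    (LinearMap.toContinuousLinearMap ((mvfderiv 𝓘(ℝ, E) V q).toLinearMap ∘ₗ S.anchor q))

/-- The Euler-Lagrange vector field `ξ_L = ξ_G - (grad V)^v` on `A`. -/
def xiL (S : LieAlgebroid E F A) (V : Q → ℝ) (a : TotalSpace F A) :
    TangentSpace (𝓘(ℝ, E).prod 𝓘(ℝ, F)) a :=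
  geodesicFlow S a - vlift E F a (grad S V a.1)

variable (F) in
/-- The Lagrangian `L(a) = G(a, a) / 2 - V(τ(a))` of mechanical type. -/
def lagrangian (V : Q → ℝ) (a : TotalSpace F A) : ℝ :=
  (1 / 2) * ⟪a.2, a.2⟫_ℝ - V a.1

/-- The Lagrangian energy `E_L = Δ(L) - L`, with `Δ` the Liouville vector field, whose value at
`a` is the velocity at `t = 0` of `t ↦ a + t a`. -/
def energy (L : TotalSpace F A → ℝ) (a : TotalSpace F A) : ℝ :=
  deriv (fun t : ℝ => L ⟨a.1, a.2 + t • a.2⟩) 0 - L a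

end Unconstrained

section Constrained

variable (E F) in
/-- `D` is a smooth vector subbundle of rank `k` of `A`: near every point it is spanned by `k`
smooth, pointwise linearly independent local sections. -/
def IsSubbundle (k : ℕ) (D : ∀ q, Submodule ℝ (A q)) : Prop :=
  ∀ q, ∃ U, IsOpen U ∧ q ∈ U ∧ ∃ s : Fin k → ∀ q', A q',
    (∀ i, ContMDiffOn 𝓘(ℝ, E) (𝓘(ℝ, E).prod 𝓘(ℝ, F)) ∞
      (fun q' => (⟨q', s i q'⟩ : TotalSpace F A)) U) ∧
    ∀ q' ∈ U, LinearIndependent ℝ (fun i => s i q') ∧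
      Submodule.span ℝ (Set.range fun i => s i q') = D q'

variable (D : ∀ q, Submodule ℝ (A q))

variable (E F) in
/-- The space `Γ(D)` of smooth sections of `D`. -/
abbrev SecD : Type _ := {X : Sec E F A // ∀ q, X q ∈ D q}

/-- The value in `D_q` of a section of `D`. -/
def SecD.eval {D : ∀ q, Submodule ℝ (A q)} (X : SecD E F D) (q : Q) : D q := ⟨X.1 q, X.2 q⟩

variable (E F) in
/-- Smoothness of a section `α` of `D*`: `α(X)` is smooth for every `X ∈ Γ(D)`. -/
def IsSmoothDualSec (α : ∀ q, Dual ℝ (D q)) : Prop :=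
  ∀ X : SecD E F D, ContMDiff 𝓘(ℝ, E) 𝓘(ℝ, ℝ) ∞ (fun q => α q (X.eval q))

variable (F) in
/-- The orthogonal projector `P : A → D ⊆ A`. -/
def projD (a : TotalSpace F A) : TotalSpace F A := ⟨a.1, (D a.1).starProjection a.2⟩

/-- The dual `i_D* : A* → D*` of the inclusion. -/
def restrictDual (μ : DualTot A) : DualTot (fun q => D q) := ⟨μ.1, μ.2 ∘ₗ (D μ.1).subtype⟩

/-- The dual `P* : D* → A*` of the orthogonal projector. -/
def projDual (ν : DualTot (fun q => D q)) : DualTot A :=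
  ⟨ν.1, ν.2 ∘ₗ ((D ν.1).orthogonalProjectionOnto).toLinearMap⟩

/-- The nonholonomic bracket `{φ, ψ}_{D*} = {φ ∘ i_D*, ψ ∘ i_D*}_{A*} ∘ P*`. -/
def nhBracket (S : LieAlgebroid E F A) (φ ψ : DualTot (fun q => D q) → ℝ)
    (ν : DualTot (fun q => D q)) : ℝ :=
  poissonBracket S (φ ∘ restrictDual D) (ψ ∘ restrictDual D) (projDual D ν)

/-- The linear function `X̂` on `D*` of a section `X` of `D`. -/
def hat {D : ∀ q, Submodule ℝ (A q)} (X : SecD E F D) (ν : DualTot (fun q => D q)) : ℝ :=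
  ν.2 (X.eval ν.1)

/-- The bracket `[X, Y]_D` on `Γ(D)` corresponding to the nonholonomic bracket: the section with
`\widehat{[X, Y]_D} = -{X̂, Ŷ}_{D*}`. -/
def bracketD (S : LieAlgebroid E F A) (X Y : SecD E F D) (q : Q) : D q :=
  Classical.epsilon fun w : D q => ∀ ν : Dual ℝ (D q), ν w = -nhBracket D S (hat X) (hat Y) ⟨q, ν⟩

/-- The anchor `ρ_D : D → TQ` corresponding to the nonholonomic bracket:
`ρ_D(X)(f) ∘ τ = {f ∘ τ, X̂}_{D*}` for all `X ∈ Γ(D)` and all smooth `f`. -/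
def anchorD (S : LieAlgebroid E F A) (q : Q) (a : D q) : TangentSpace 𝓘(ℝ, E) q :=
  Classical.epsilon fun v : TangentSpace 𝓘(ℝ, E) q =>
    ∀ X : SecD E F D, X.eval q = a → ∀ f : Q → ℝ, ContMDiff 𝓘(ℝ, E) 𝓘(ℝ, ℝ) ∞ f →
      ∀ ν : Dual ℝ (D q),
        mvfderiv 𝓘(ℝ, E) f q v = nhBracket D S (fun ν' => f ν'.1) (hat X) ⟨q, ν⟩

/-- The almost differential of a function: `(d^D f)(a) = ρ_D(a)(f)`. -/
def dFun (S : LieAlgebroid E F A) (f : Q → ℝ) (q : Q) (a : D q) : ℝ :=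
  mvfderiv 𝓘(ℝ, E) f q (anchorD D S q a)

/-- The almost differential of a section `α` of `D*`:
`(d^D α)(X, Y) = ρ_D(X)(α(Y)) - ρ_D(Y)(α(X)) - α([X, Y]_D)`. -/
def dForm (S : LieAlgebroid E F A) (α : ∀ q, Dual ℝ (D q)) (X Y : SecD E F D) (q : Q) : ℝ :=
  dFun D S (fun q' => α q' (Y.eval q')) q (X.eval q) - dFun D S (fun q' => α q' (X.eval q')) q (Y.eval q)
    - α q (bracketD D S X Y q)

/-- `H^0(d^D) = {f ∈ C^∞(Q) | d^D f = 0}`. -/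
def H0 (S : LieAlgebroid E F A) : Submodule ℝ C^∞⟮𝓘(ℝ, E), Q; 𝓘(ℝ, ℝ), ℝ⟯ where
  carrier := {f | ∀ q a, dFun D S f q a = 0}
  zero_mem' q a := by
    have h : mvfderiv 𝓘(ℝ, E) (fun _ : Q => (0 : ℝ)) q = 0 := mvfderiv_const 0
    change mvfderiv 𝓘(ℝ, E) (fun _ : Q => (0 : ℝ)) q _ = 0
    rw [h]; rfl
  add_mem' {f g} hf hg q a := by
    have h := mvfderiv_add (f.contMDiff.mdifferentiable (by simp) q)
      (g.contMDiff.mdifferentiable (by simp) q)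
    change mvfderiv 𝓘(ℝ, E) (⇑f + ⇑g) q _ = 0
    rw [h]
    have h1 := hf q a
    have h2 := hg q a
    simp only [dFun] at h1 h2
    simp [h1, h2]
  smul_mem' c f hf q a := by
    have h := mvfderiv_smul (a := fun _ : Q => c) mdifferentiableAt_const
      (f.contMDiff.mdifferentiable (by simp) q)
    change mvfderiv 𝓘(ℝ, E) ((fun _ : Q => c) • ⇑f) q _ = 0
    rw [h]
    have h1 := hf q a
    simp only [dFun] at h1
    simp [h1, mvfderiv_const]

/-- The smallest Lie algebra of vector fields on `Q` containing `𝒟`. -/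
inductive LieHull (𝒟 : Set (∀ q : Q, TangentSpace 𝓘(ℝ, E) q)) :
    (∀ q : Q, TangentSpace 𝓘(ℝ, E) q) → Prop
  | of (X) : X ∈ 𝒟 → LieHull 𝒟 X
  | add (X Y) : LieHull 𝒟 X → LieHull 𝒟 Y → LieHull 𝒟 (X + Y)
  | smul (c : ℝ) (X) : LieHull 𝒟 X → LieHull 𝒟 (c • X)
  | lie (X Y) : LieHull 𝒟 X → LieHull 𝒟 Y → LieHull 𝒟 (VectorField.mlieBracket 𝓘(ℝ, E) X Y)

/-- The smooth vector fields on `Q` with values in the generalized distribution `ρ_D(D)`. -/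
def tangentFields (S : LieAlgebroid E F A) : Set (∀ q : Q, TangentSpace 𝓘(ℝ, E) q) :=
  {X | ContMDiff 𝓘(ℝ, E) 𝓘(ℝ, E).tangent ∞
        (fun q => (⟨q, X q⟩ : TangentBundle 𝓘(ℝ, E) Q)) ∧
      ∀ q, ∃ a : D q, anchorD D S q a = X q}

/-- `D` is completely nonholonomic: `Lie^∞_q(ρ_D(D)) = T_qQ` for all `q`. -/
def CompletelyNonholonomic (S : LieAlgebroid E F A) : Prop :=
  ∀ (q : Q) (v : TangentSpace 𝓘(ℝ, E) q), ∃ X, LieHull (tangentFields D S) X ∧ X q = v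

open Classical in
/-- The vector field `ξ_{(L,D)} = TP ∘ ξ_L ∘ i_D` on `D` of the constrained dynamics, as a vector
field on `A` along `D` (with value zero off `D`, that is, where `P(a) ≠ a`). -/
def xiLD (S : LieAlgebroid E F A) (V : Q → ℝ) (a : TotalSpace F A) :
    TangentSpace (𝓘(ℝ, E).prod 𝓘(ℝ, F)) a :=
  if h : projD F D a = a then
    tangentCast h
      (mfderiv (𝓘(ℝ, E).prod 𝓘(ℝ, F)) (𝓘(ℝ, E).prod 𝓘(ℝ, F)) (projD F D) a (xiL S V a))
  else 0

/-- The curve `σ : J → D` solves the Lagrange-d'Alembert equations of `(L, D)`: it is an integral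
curve of `ξ_{(L,D)}`. -/
def IsLagrangeDAlembertSolution (S : LieAlgebroid E F A) (V : Q → ℝ) (σ : ℝ → TotalSpace F A)
    (J : Set ℝ) : Prop :=
  (∀ t ∈ J, (σ t).2 ∈ D (σ t).1) ∧ IsMIntegralCurveOn σ (xiLD D S V) J

/-- The inverse `#_{G_D} : D* → D` of the musical isomorphism of the metric of `D`. -/
def sharpD {q : Q} (ν : Dual ℝ (D q)) : D q :=
  (InnerProductSpace.toDual ℝ (D q)).symm (LinearMap.toContinuousLinearMap ν)

variable (F) in
/-- The map `#_{G_D} ∘ α : Q → D ⊆ A`. -/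
def sharpSec (α : ∀ q, Dual ℝ (D q)) (q : Q) : TotalSpace F A := ⟨q, (sharpD D (α q) : A q)⟩

/-- The vector field `ξ_{(L,D)α}(q) = (Tτ_D)(ξ_{(L,D)}(#_{G_D}(α(q))))` on `Q`. -/
def xiLDalpha (S : LieAlgebroid E F A) (V : Q → ℝ) (α : ∀ q, Dual ℝ (D q)) (q : Q) :
    TangentSpace 𝓘(ℝ, E) q :=
  mfderiv (𝓘(ℝ, E).prod 𝓘(ℝ, F)) 𝓘(ℝ, E) (TotalSpace.proj : TotalSpace F A → Q)
    (sharpSec F D α q) (xiLD D S V (sharpSec F D α q))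

/-- For every integral curve `c` of `ξ_{(L,D)α}` on an open interval, `#_{G_D} ∘ α ∘ c` is a
solution of the Lagrange-d'Alembert equations. -/
def LiftsIntegralCurves (S : LieAlgebroid E F A) (V : Q → ℝ) (α : ∀ q, Dual ℝ (D q)) : Prop :=
  ∀ (J : Set ℝ) (c : ℝ → Q), IsOpen J → J.OrdConnected →
    IsMIntegralCurveOn c (xiLDalpha D S V α) J →
    IsLagrangeDAlembertSolution D S V (fun t => sharpSec F D α (c t)) J

variable (F) in
/-- The function `(E_L)|_D ∘ #_{G_D} ∘ α` on `Q`. -/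
def energyAlong (V : Q → ℝ) (α : ∀ q, Dual ℝ (D q)) (q : Q) : ℝ :=
  energy (lagrangian F V) (sharpSec F D α q)

end Constrained

end NonholonomicHJ

end

noncomputable section

namespace NonholonomicHJ

variable {E : Type*} [NormedAddCommGroup E] [NormedSpace ℝ E] [FiniteDimensional ℝ E]
  {Q : Type*} [TopologicalSpace Q] [ChartedSpace E Q] [IsManifold 𝓘(ℝ, E) ∞ Q] [T2Space Q]
  {F : Type*} [NormedAddCommGroup F] [NormedSpace ℝ F] [FiniteDimensional ℝ F]
  {A : Q → Type*} [TopologicalSpace (TotalSpace F A)] [∀ q, NormedAddCommGroup (A q)]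
  [∀ q, InnerProductSpace ℝ (A q)] [∀ q, FiniteDimensional ℝ (A q)]
  [FiberBundle F A] [VectorBundle ℝ F A] [ContMDiffVectorBundle ∞ F A 𝓘(ℝ, E)]

set_option linter.unusedSectionVars false


/-! Write X for the section #α of D. Along X the constrained field splits as TX(ρ_A(X)) minus the
vertical lift of some y in D_q, where for Z in Γ(D) one has ⟨y, Z⟩ = ρ(X)⟨X, Z⟩ - ½ ρ(Z)⟨X, X⟩ + ⟨X,
[Z, X]⟩ + ρ(Z)(V) (`exists_xiLD_eq`). Closedness of α, tested on X and Z, trades the first and third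
terms for ρ(Z)⟨X, X⟩, so that ⟨y, Z⟩ = d^D(E_L ∘ X)(Z) (`exists_xiLD_sharp`): the failure of the
constrained field to be tangent to the image of #α is exactly the D-gradient of the energy.

Projected to Q, the field becomes ρ_A(X), and the lift of an integral curve c has velocity
TX(ρ_A(X)). It is a solution precisely when y vanishes along c. Since every point of Q lies on an
integral curve, (i) and (ii) agree (`liftsIntegralCurves_iff`).

For (iii), constants lie in H^0(d^D), so H^0 ≅ ℝ leaves nothing else. In the completely nonholonomic
case, a function killed by ρ_D(D) is killed by all iterated Lie brackets, hence has zero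
differential, and connectedness finishes the argument.

The coordinate definition of the Poisson bracket and the choices by `Classical.epsilon` are turned
into intrinsic formulas by showing that suitable expressions are tensorial (`poissonBracket_linear`,
`anchorD_eq`, `bracketD_eq`, `leviCivita_spec`). -/

/-- Multiplication of a smooth section by a smooth function. -/
def fsmul (f : Q → ℝ) (hf : ContMDiff 𝓘(ℝ, E) 𝓘(ℝ, ℝ) ∞ f) (Z : Sec E F A) : Sec E F A :=
  ⟨fun q => f q • Z q, hf.smul_section Z.contMDiff⟩

@[simp] theorem fsmul_apply (f : Q → ℝ) (hf : ContMDiff 𝓘(ℝ, E) 𝓘(ℝ, ℝ) ∞ f) (Z : Sec E F A)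
    (q : Q) : fsmul f hf Z q = f q • Z q := rfl

/-! ### Tensoriality at a point -/

/-- A real-valued operation on smooth sections is tensorial at `q` if it is additive and commutes
with multiplication by smooth functions, evaluated at `q`. -/
structure IsTensorialAt (T : Sec E F A → ℝ) (q : Q) : Prop where
  add : ∀ X Y, T (X + Y) = T X + T Y
  smul : ∀ f hf X, T (fsmul f hf X) = f q * T X

/-- A smooth bump function at `q` supported in a given neighbourhood. -/
theorem exists_bump (q : Q) {u : Set Q} (hu : u ∈ 𝓝 q) :
    ∃ χ : Q → ℝ, ContMDiff 𝓘(ℝ, E) 𝓘(ℝ, ℝ) ∞ χ ∧ χ q = 1 ∧ (∀ᶠ q' in 𝓝 q, χ q' = 1) ∧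
      tsupport χ ⊆ u := by
  obtain ⟨f, -, hf⟩ :=
    (SmoothBumpFunction.nhds_basis_tsupport (I := 𝓘(ℝ, E)) q).mem_iff.1 hu
  exact ⟨f, f.contMDiff, f.eq_one, f.eventuallyEq_one, hf⟩

/-- The product of a smooth function with a function that is smooth on an open set containing its
support is smooth. -/
theorem contMDiff_mul_of_tsupport {χ g : Q → ℝ} {u : Set Q}
    (hχ : ContMDiff 𝓘(ℝ, E) 𝓘(ℝ, ℝ) ∞ χ) (hs : tsupport χ ⊆ u)
    (hg : ∀ q ∈ u, ContMDiffAt 𝓘(ℝ, E) 𝓘(ℝ, ℝ) ∞ g q) :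
    ContMDiff 𝓘(ℝ, E) 𝓘(ℝ, ℝ) ∞ (fun q => χ q * g q) := by
  refine contMDiff_of_tsupport fun q hq => ?_
  exact (hχ q).mul (hg q (hs (closure_mono (Function.support_mul_subset_left χ g) hq)))

theorem IsTensorialAt.sum {T : Sec E F A → ℝ} {q : Q} (hT : IsTensorialAt T q) {ι : Type*}
    (s : Finset ι) (X : ι → Sec E F A) : T (∑ i ∈ s, X i) = ∑ i ∈ s, T (X i) := by
  classical
  have h0 : T 0 = 0 := by simpa using hT.add 0 0
  induction s using Finset.induction_on with
  | empty => simpa using h0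
  | insert a s ha ih => rw [Finset.sum_insert ha, Finset.sum_insert ha, hT.add, ih]

theorem sum_sec_apply {ι : Type*} (s : Finset ι) (X : ι → Sec E F A) (q : Q) :
    (∑ i ∈ s, X i) q = ∑ i ∈ s, X i q := by
  classical
  induction s using Finset.induction_on with
  | empty => simp
  | insert a s ha ih => rw [Finset.sum_insert ha, Finset.sum_insert ha, ← ih]; rfl

/-- In a local frame the coefficients of Z vanish at q, and a cut-off makes the frame expansion
global so that additivity and linearity over functions apply. -/
theorem IsTensorialAt.eq_zero {T : Sec E F A → ℝ} {q : Q} (hT : IsTensorialAt T q)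
    {Z : Sec E F A} (hZ : Z q = 0) : T Z = 0 := by
  have : ContMDiffVectorBundle 1 F A 𝓘(ℝ, E) := ContMDiffVectorBundle.of_le (n := ∞) (by simp)
  let t := trivializationAt F A q
  have hq : q ∈ t.baseSet := FiberBundle.mem_baseSet_trivializationAt F A q
  let b := finBasis ℝ F
  obtain ⟨χ, hχ, hχ1, -, hχs⟩ := exists_bump (E := E) q (t.open_baseSet.mem_nhds hq)
  let s : ∀ _ : Fin (finrank ℝ F), Sec E F A := fun i =>
    ⟨_, ContMDiffOn.smul_section_of_tsupport hχ.contMDiffOn t.open_baseSet hχs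
      (t.contMDiffOn_localFrame_baseSet (I := 𝓘(ℝ, E)) ∞ b i)⟩
  let c : ∀ _ : Fin (finrank ℝ F), Q → ℝ := fun i q' =>
    χ q' * t.localFrameCoeff 𝓘(ℝ, E) b i q' (Z q')
  have hc : ∀ i, ContMDiff 𝓘(ℝ, E) 𝓘(ℝ, ℝ) ∞ (c i) := fun i =>
    contMDiff_mul_of_tsupport hχ hχs fun q' hq' =>
      contMDiffAt_localFrameCoeff b hq' (Z.contMDiff q') i
  -- The factor is χ² because one χ extends each coefficient and the other extends the corresponding
  -- frame section.
  have key : fsmul (fun q' => χ q' * χ q') (hχ.mul hχ) Z = ∑ i, fsmul (c i) (hc i) (s i) := by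
    ext q'
    rw [sum_sec_apply]
    simp only [fsmul_apply]
    by_cases h : q' ∈ t.baseSet
    · have h' := t.eq_sum_localFrameCoeff_smul (I := 𝓘(ℝ, E)) (b := b) (s := fun q => Z q) h
      conv_lhs => rw [h']
      rw [Finset.smul_sum]
      refine Finset.sum_congr rfl fun i _ => ?_
      simp only [c, s, ContMDiffSection.coeFn_mk, Pi.smul_apply', smul_smul]
      congr 1; ring
    · have : χ q' = 0 := by
        by_contra h0
        exact h (hχs (subset_tsupport _ h0))
      simp [c, this]
  have h1 := hT.smul (fun q' => χ q' * χ q') (hχ.mul hχ) Z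
  have h2 : ∀ i, c i q = 0 := fun i => by simp [c, hZ]
  rw [key, hT.sum] at h1
  simp only [hT.smul, h2, zero_mul, Finset.sum_const_zero, hχ1, one_mul] at h1
  exact h1.symm

theorem IsTensorialAt.congr {T : Sec E F A → ℝ} {q : Q} (hT : IsTensorialAt T q)
    {Z Z' : Sec E F A} (h : Z q = Z' q) : T Z = T Z' := by
  have h1 := hT.add (Z - Z') Z'
  rw [hT.eq_zero (Z := Z - Z') (by simp [h])] at h1
  simpa using h1

/-- The derivative of a product of real functions. -/
theorem mvfderiv_mul_apply {M : Type*} {E' H : Type*} [NormedAddCommGroup E'] [NormedSpace ℝ E']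
    [TopologicalSpace H] {I : ModelWithCorners ℝ E' H} [TopologicalSpace M] [ChartedSpace H M]
    {f g : M → ℝ} {x : M} (hf : MDifferentiableAt I 𝓘(ℝ, ℝ) f x)
    (hg : MDifferentiableAt I 𝓘(ℝ, ℝ) g x) (v : TangentSpace I x) :
    mvfderiv I (fun y => f y * g y) x v = f x * mvfderiv I g x v + g x * mvfderiv I f x v := by
  have := congrArg (fun L => L v) (mvfderiv_fun_mul hf hg)
  simpa using this

theorem mvfderiv_add_apply {M : Type*} {E' H : Type*} [NormedAddCommGroup E'] [NormedSpace ℝ E']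
    [TopologicalSpace H] {I : ModelWithCorners ℝ E' H} [TopologicalSpace M] [ChartedSpace H M]
    {f g : M → ℝ} {x : M} (hf : MDifferentiableAt I 𝓘(ℝ, ℝ) f x)
    (hg : MDifferentiableAt I 𝓘(ℝ, ℝ) g x) (v : TangentSpace I x) :
    mvfderiv I (fun y => f y + g y) x v = mvfderiv I f x v + mvfderiv I g x v := by
  have := congrArg (fun L => L v) (mvfderiv_fun_add hf hg)
  simpa using this

theorem mvfderiv_congr {M : Type*} {E' H : Type*} [NormedAddCommGroup E'] [NormedSpace ℝ E']
    [TopologicalSpace H] {I : ModelWithCorners ℝ E' H} [TopologicalSpace M] [ChartedSpace H M]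
    {f g : M → ℝ} {x : M} (h : f =ᶠ[𝓝 x] g) (v : TangentSpace I x) :
    mvfderiv I f x v = mvfderiv I g x v := by
  simp only [mvfderiv, ContinuousLinearMap.comp_apply, h.mfderiv_eq]
  rfl

theorem bracket_fsmul_right (S : LieAlgebroid E F A) (X Y : Sec E F A) (f : Q → ℝ)
    (hf : ContMDiff 𝓘(ℝ, E) 𝓘(ℝ, ℝ) ∞ f) (q : Q) :
    S.bracket X (fsmul f hf Y) q =
      f q • S.bracket X Y q + mvfderiv 𝓘(ℝ, E) f q (S.anchor q (X q)) • Y q :=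
  S.leibniz X Y _ f hf (fun _ => rfl) q

theorem bracket_skew_apply (S : LieAlgebroid E F A) (X Y : Sec E F A) (q : Q) :
    S.bracket X Y q = -S.bracket Y X q := by
  rw [S.skew]; rfl

/-! ### Momenta and the linear Poisson bracket -/

variable (F) in
/-- The momentum `μ ∈ A*_q`, transported to nearby fibres by the trivialization of `A` at `q`. -/
def momentum (μ : DualTot A) (q' : Q) : Dual ℝ (A q') :=
  μ.2 ∘ₗ ((trivializationAt F A μ.1).symmL ℝ μ.1).toLinearMap ∘ₗ
    ((trivializationAt F A μ.1).continuousLinearMapAt ℝ q').toLinearMap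

theorem constMomentum_eq (μ : DualTot A) (q' : Q) : constMomentum F μ q' = ⟨q', momentum F μ q'⟩ :=
  rfl

theorem momentum_apply (μ : DualTot A) (q' : Q) (a : A q') :
    momentum F μ q' a = μ.2 ((trivializationAt F A μ.1).symmL ℝ μ.1
      ((trivializationAt F A μ.1).continuousLinearMapAt ℝ q' a)) :=
  rfl

/-- The pairing of a section with a local section of `A*` of constant momenta is smooth at the
base point. -/
theorem contMDiffAt_momentum (μ : DualTot A) (Y : Sec E F A) :
    ContMDiffAt 𝓘(ℝ, E) 𝓘(ℝ, ℝ) ∞ (fun q' => momentum F μ q' (Y q')) μ.1 := by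
  let e := trivializationAt F A μ.1
  have hq : μ.1 ∈ e.baseSet := FiberBundle.mem_baseSet_trivializationAt F A μ.1
  let l : F →L[ℝ] ℝ := LinearMap.toContinuousLinearMap (μ.2 ∘ₗ (e.symmL ℝ μ.1).toLinearMap)
  have h1 := (contMDiffAt_section (IB := 𝓘(ℝ, E)) μ.1).1 (Y.contMDiff μ.1)
  have h2 := l.contMDiff.contMDiffAt.comp μ.1 h1
  refine h2.congr_of_eventuallyEq ?_
  filter_upwards [e.open_baseSet.mem_nhds hq] with q' hq'
  rw [momentum_apply, Trivialization.continuousLinearMapAt_apply_of_mem ℝ _ hq']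
  rfl

theorem momentum_self (μ : DualTot A) (a : A μ.1) :
    momentum F μ μ.1 a = μ.2 a := by
  have hq : μ.1 ∈ (trivializationAt F A μ.1).baseSet :=
    FiberBundle.mem_baseSet_trivializationAt F A μ.1
  rw [momentum_apply, (trivializationAt F A μ.1).symmL_continuousLinearMapAt hq]

/-- The pairing of a momentum with `[X, Y]`, corrected by the derivative of the momentum of `Y`
along `X`, is tensorial in `Y`. -/
theorem isTensorialAt_bracket_sub (S : LieAlgebroid E F A) (μ : DualTot A) (X : Sec E F A) :
    IsTensorialAt (fun Y : Sec E F A => μ.2 (S.bracket X Y μ.1) -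
      mvfderiv 𝓘(ℝ, E) (fun q' => momentum F μ q' (Y q')) μ.1
        (S.anchor μ.1 (X μ.1))) μ.1 where
  add Y Z := by
    have hY := (contMDiffAt_momentum (E := E) μ Y).mdifferentiableAt (by simp)
    have hZ := (contMDiffAt_momentum (E := E) μ Z).mdifferentiableAt (by simp)
    have h := mvfderiv_add_apply hY hZ (S.anchor μ.1 (X μ.1))
    simp only [map_add, ContMDiffSection.coe_add, Pi.add_apply]
    rw [h]; ring
  smul f hf Y := by
    have hY := (contMDiffAt_momentum (E := E) μ Y).mdifferentiableAt (by simp)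
    have h := mvfderiv_mul_apply ((hf μ.1).mdifferentiableAt (by simp)) hY (S.anchor μ.1 (X μ.1))
    simp only [fsmul_apply, map_smul, smul_eq_mul, bracket_fsmul_right, map_add]
    rw [h, momentum_self]; ring

/-- Near the base point both the momentum and the section have constant components in the same
trivialization, so their pairing is locally constant. -/
theorem mvfderiv_momentum_secThrough (μ : DualTot A) (a : A μ.1)
    (v : TangentSpace 𝓘(ℝ, E) μ.1) :
    mvfderiv 𝓘(ℝ, E) (fun q' => momentum F μ q' (secThrough E F a q')) μ.1 v = 0 := by
  have hq : μ.1 ∈ (trivializationAt F A μ.1).baseSet :=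
    FiberBundle.mem_baseSet_trivializationAt F A μ.1
  have : (fun q' => momentum F μ q' (secThrough E F a q')) =ᶠ[𝓝 μ.1]
      fun _ => μ.2 a := by
    filter_upwards [(exists_sec E F a).choose_spec,
      (trivializationAt F A μ.1).open_baseSet.mem_nhds hq] with q' h1 h2
    change momentum F μ q' ((exists_sec E F a).choose q') = _
    rw [h1]
    rw [momentum_apply, FiberBundle.extend,
      Trivialization.continuousLinearMapAt_apply_of_mem ℝ _ h2,
      Trivialization.apply_mk_symm _ h2,
      ← Trivialization.continuousLinearMapAt_apply_of_mem ℝ _ hq,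
      Trivialization.symmL_continuousLinearMapAt _ hq]
  rw [mvfderiv_congr this, mvfderiv_const]; rfl

/-- The coordinate expression of the linear Poisson bracket on linear functions. -/
theorem bracket_eq_momentum (S : LieAlgebroid E F A) (μ : DualTot A) (X Y : Sec E F A) :
    μ.2 (S.bracket X Y μ.1) =
      mvfderiv 𝓘(ℝ, E) (fun q' => momentum F μ q' (Y q')) μ.1 (S.anchor μ.1 (X μ.1))
      - mvfderiv 𝓘(ℝ, E) (fun q' => momentum F μ q' (X q')) μ.1 (S.anchor μ.1 (Y μ.1))
      + μ.2 (S.bracket (secThrough E F (X μ.1)) (secThrough E F (Y μ.1)) μ.1) := by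
  -- Replace Y, then X, by a section of constant components with the same value. Only the corrected
  -- bracket allows this, and its correction vanishes on the new sections; skew-symmetry brings X
  -- into the tensorial slot.
  have h1 := (isTensorialAt_bracket_sub S μ X).congr
    (Z := Y) (Z' := secThrough E F (Y μ.1)) (secThrough_apply E F _).symm
  have h2 := (isTensorialAt_bracket_sub S μ (secThrough E F (Y μ.1))).congr
    (Z := X) (Z' := secThrough E F (X μ.1)) (secThrough_apply E F _).symm
  simp only [mvfderiv_momentum_secThrough, secThrough_apply] at h1 h2
  rw [bracket_skew_apply S _ X, bracket_skew_apply S _ (secThrough E F (X μ.1)), map_neg,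
    map_neg] at h2
  linarith

theorem fibreDeriv_linear (φ : DualTot A → ℝ) (X : ∀ q, A q) (hφ : ∀ μ, φ μ = μ.2 (X μ.1))
    (μ : DualTot A) : fibreDeriv φ μ = X μ.1 := by
  have : ∀ i, deriv (fun t : ℝ => φ ⟨μ.1, μ.2 + t • (finBasis ℝ (A μ.1)).coord i⟩) 0 =
      (finBasis ℝ (A μ.1)).coord i (X μ.1) := fun i => by
    simp only [hφ, LinearMap.add_apply, LinearMap.smul_apply, smul_eq_mul]
    have h := ((hasDerivAt_id (0 : ℝ)).mul_const
      ((finBasis ℝ (A μ.1)).coord i (X μ.1))).const_add (μ.2 (X μ.1))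
    simp
  simp only [fibreDeriv, this, Basis.coord_apply]
  exact (finBasis ℝ (A μ.1)).sum_repr _

theorem fibreDeriv_basic (f : Q → ℝ) (μ : DualTot A) :
    fibreDeriv (fun μ' : DualTot A => f μ'.1) μ = 0 := by
  simp [fibreDeriv]

theorem poissonBracket_linear (S : LieAlgebroid E F A) (φ ψ : DualTot A → ℝ) (X Y : Sec E F A)
    (hφ : ∀ μ, φ μ = μ.2 (X μ.1)) (hψ : ∀ μ, ψ μ = μ.2 (Y μ.1)) (μ : DualTot A) :
    poissonBracket S φ ψ μ = -μ.2 (S.bracket X Y μ.1) := by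
  rw [poissonBracket, fibreDeriv_linear φ (fun q => X q) hφ, fibreDeriv_linear ψ (fun q => Y q) hψ,
    bracket_eq_momentum S μ X Y]
  simp only [hφ, hψ, constMomentum_eq]
  ring

theorem poissonBracket_basic_linear (S : LieAlgebroid E F A) (f : Q → ℝ) (ψ : DualTot A → ℝ)
    (Y : Sec E F A) (hψ : ∀ μ, ψ μ = μ.2 (Y μ.1)) (μ : DualTot A) :
    poissonBracket S (fun μ' => f μ'.1) ψ μ =
      mvfderiv 𝓘(ℝ, E) f μ.1 (S.anchor μ.1 (Y μ.1)) := by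
  -- `secThrough` of the zero vector need not be the zero section. Taking X = 0 in the coordinate
  -- formula shows that its bracket term vanishes nevertheless.
  have h0 := bracket_eq_momentum S μ 0 Y
  simp only [ContMDiffSection.coe_zero, Pi.zero_apply, map_zero, LinearMap.zero_apply] at h0
  rw [poissonBracket, fibreDeriv_basic, fibreDeriv_linear ψ (fun q => Y q) hψ, map_zero, map_zero,
    sub_zero]
  have h1 : (0 : ℝ) = μ.2 (S.bracket (secThrough E F (0 : A μ.1))
    (secThrough E F (Y μ.1)) μ.1) := by
    rw [mvfderiv_const (0 : ℝ)] at h0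
    simpa using h0
  rw [← h1, sub_zero]
  rfl

/-! ### Subbundles, the orthogonal projector and the algebroid structure of D -/

section Subbundle

variable [IsContMDiffRiemannianBundle 𝓘(ℝ, E) ∞ F A]

theorem contMDiff_inner (X Y : Sec E F A) :
    ContMDiff 𝓘(ℝ, E) 𝓘(ℝ, ℝ) ∞ (fun q => ⟪X q, Y q⟫_ℝ) :=
  ContMDiff.inner_bundle (b := fun q : Q => q) X.contMDiff Y.contMDiff

theorem mdifferentiableAt_inner (X Y : Sec E F A) (q : Q) :
    MDifferentiableAt 𝓘(ℝ, E) 𝓘(ℝ, ℝ) (fun q => ⟪X q, Y q⟫_ℝ) q :=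
  (contMDiff_inner X Y).mdifferentiable (by simp) q

/-- Induction on the index: each step subtracts smooth multiples of earlier vectors, whose
denominators are nonzero by pointwise independence. -/
theorem contMDiffOn_gramSchmidt {k : ℕ} {U : Set Q} {s : Fin k → ∀ q', A q'}
    (hs : ∀ i, ContMDiffOn 𝓘(ℝ, E) (𝓘(ℝ, E).prod 𝓘(ℝ, F)) ∞
      (fun q' => (⟨q', s i q'⟩ : TotalSpace F A)) U)
    (hli : ∀ q' ∈ U, LinearIndependent ℝ (fun i => s i q')) (i : Fin k) :
    ContMDiffOn 𝓘(ℝ, E) (𝓘(ℝ, E).prod 𝓘(ℝ, F)) ∞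
      (fun q' => (⟨q', InnerProductSpace.gramSchmidt ℝ (fun i => s i q') i⟩ : TotalSpace F A)) U := by
  induction i using WellFoundedLT.induction with
  | ind i ih =>
    have hterm : ∀ j ∈ Finset.Iio i, ContMDiffOn 𝓘(ℝ, E) (𝓘(ℝ, E).prod 𝓘(ℝ, F)) ∞
        (fun q' => (⟨q', (⟪InnerProductSpace.gramSchmidt ℝ (fun i => s i q') j, s i q'⟫_ℝ /
          ⟪InnerProductSpace.gramSchmidt ℝ (fun i => s i q') j,
            InnerProductSpace.gramSchmidt ℝ (fun i => s i q') j⟫_ℝ) •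
          InnerProductSpace.gramSchmidt ℝ (fun i => s i q') j⟩ : TotalSpace F A)) U := by
      intro j hj
      have hj' := ih j (Finset.mem_Iio.1 hj)
      refine ContMDiffOn.smul_section (ContMDiffOn.div₀ ?_ ?_ ?_) hj'
      · exact ContMDiffOn.inner_bundle (b := fun q : Q => q) hj' (hs i)
      · exact ContMDiffOn.inner_bundle (b := fun q : Q => q) hj' hj'
      · intro q' hq'
        rw [inner_self_ne_zero]
        exact InnerProductSpace.gramSchmidt_ne_zero j (hli q' hq')
    refine ((hs i).sub_section (ContMDiffOn.sum_section hterm)).congr fun q' hq' => ?_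
    rw [InnerProductSpace.gramSchmidt_def]
    simp only [Submodule.starProjection_singleton, ← real_inner_self_eq_norm_sq]
    rfl

variable {D : ∀ q, Submodule ℝ (A q)}

/-- Near every point the orthogonal projector onto a subbundle `D` is given by finitely many
sections of `D`. -/
theorem exists_projection_frame {k : ℕ} (hD : IsSubbundle E F k D) (q : Q) :
    ∃ u w : Fin k → SecD E F D, ∀ᶠ q' in 𝓝 q, ∀ a : A q',
      (D q').starProjection a = ∑ i, ⟪(w i).1 q', a⟫_ℝ • (u i).1 q' := by
  obtain ⟨U, hU, hqU, s, hs, hsp⟩ := hD q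
  let g : Fin k → ∀ q', A q' := fun i q' => InnerProductSpace.gramSchmidt ℝ (fun i => s i q') i
  have hg : ∀ i, ContMDiffOn 𝓘(ℝ, E) (𝓘(ℝ, E).prod 𝓘(ℝ, F)) ∞
      (fun q' => (⟨q', g i q'⟩ : TotalSpace F A)) U :=
    contMDiffOn_gramSchmidt hs fun q' hq' => (hsp q' hq').1
  have hg0 : ∀ i, ∀ q' ∈ U, ⟪g i q', g i q'⟫_ℝ ≠ 0 := fun i q' hq' => by
    rw [inner_self_ne_zero]
    exact InnerProductSpace.gramSchmidt_ne_zero i (hsp q' hq').1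
  have hspan : ∀ q' ∈ U, Submodule.span ℝ (Set.range fun i => g i q') = D q' := fun q' hq' => by
    rw [← (hsp q' hq').2]
    exact InnerProductSpace.span_gramSchmidt ℝ (fun i => s i q')
  have hgD : ∀ i, ∀ q' ∈ U, g i q' ∈ D q' := fun i q' hq' => by
    rw [← hspan q' hq']
    exact Submodule.subset_span ⟨i, rfl⟩
  -- The dual frame g_i/|g_i|² gives P(a) = Σ ⟨h_i, a⟩ g_i without normalising by square roots.
  let h : Fin k → ∀ q', A q' := fun i q' => (⟪g i q', g i q'⟫_ℝ)⁻¹ • g i q'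
  have hh : ∀ i, ContMDiffOn 𝓘(ℝ, E) (𝓘(ℝ, E).prod 𝓘(ℝ, F)) ∞
      (fun q' => (⟨q', h i q'⟩ : TotalSpace F A)) U := fun i =>
    ContMDiffOn.smul_section (ContMDiffOn.inv₀
      (ContMDiffOn.inner_bundle (b := fun q : Q => q) (hg i) (hg i)) (hg0 i)) (hg i)
  obtain ⟨χ, hχ, -, hχ1, hχs⟩ := exists_bump (E := E) q (hU.mem_nhds hqU)
  have hχ0 : ∀ q', q' ∉ U → χ q' = 0 := fun q' hq' => by
    by_contra h0
    exact hq' (hχs (subset_tsupport _ h0))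
  refine ⟨fun i => ⟨⟨_, ContMDiffOn.smul_section_of_tsupport hχ.contMDiffOn hU hχs (hg i)⟩, ?_⟩,
    fun i => ⟨⟨_, ContMDiffOn.smul_section_of_tsupport hχ.contMDiffOn hU hχs (hh i)⟩, ?_⟩, ?_⟩
  · intro q'
    simp only [ContMDiffSection.coeFn_mk, Pi.smul_apply']
    by_cases hq' : q' ∈ U
    · exact Submodule.smul_mem _ _ (hgD i q' hq')
    · simp [hχ0 q' hq']
  · intro q'
    simp only [ContMDiffSection.coeFn_mk, Pi.smul_apply']
    by_cases hq' : q' ∈ U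
    · exact Submodule.smul_mem _ _ (Submodule.smul_mem _ _ (hgD i q' hq'))
    · simp [hχ0 q' hq']
  · filter_upwards [hχ1, hU.mem_nhds hqU] with q' h1 hq' a
    simp only [ContMDiffSection.coeFn_mk, Pi.smul_apply', h1, one_smul]
    refine Submodule.eq_starProjection_of_mem_of_inner_eq_zero
      (Submodule.sum_mem _ fun i _ => Submodule.smul_mem _ _ (hgD i q' hq')) fun x hx => ?_
    rw [← hspan q' hq'] at hx
    induction hx using Submodule.span_induction with
    | mem x hx =>
      obtain ⟨j, rfl⟩ := hx
      simp only [inner_sub_left, sum_inner, inner_smul_left, h]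
      rw [Finset.sum_eq_single j]
      · have := hg0 j q' hq'
        simp only [conj_trivial, real_inner_comm a]
        field_simp
        simp
      · intro i _ hij
        have : ⟪g i q', g j q'⟫_ℝ = 0 := InnerProductSpace.gramSchmidt_orthogonal ℝ _ hij
        simp [this]
      · simp
    | zero => simp
    | add x y _ _ hx hy => rw [inner_add_right, hx, hy, add_zero]
    | smul c x _ hx => rw [inner_smul_right, hx, mul_zero]

/-- Every vector of a subbundle is the value of a global section. -/
theorem exists_secD {k : ℕ} (hD : IsSubbundle E F k D) {q : Q} (a : D q) :
    ∃ X : SecD E F D, X.eval q = a := by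
  obtain ⟨u, w, h⟩ := exists_projection_frame hD q
  refine ⟨⟨∑ i, ⟪(w i).1 q, (a : A q)⟫_ℝ • (u i).1, fun q' => ?_⟩, ?_⟩
  · rw [sum_sec_apply]
    exact Submodule.sum_mem _ fun i _ => Submodule.smul_mem _ _ ((u i).2 q')
  · ext
    have := h.self_of_nhds (a : A q)
    rw [Submodule.starProjection_eq_self_iff.2 a.2] at this
    conv_rhs => rw [this]
    change (∑ i, ⟪(w i).1 q, (a : A q)⟫_ℝ • (u i).1) q = _
    rw [sum_sec_apply]
    rfl

theorem inner_sharpD {q : Q} (ν : Dual ℝ (D q)) (x : D q) :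
    ⟪(sharpD D ν : A q), (x : A q)⟫_ℝ = ν x := by
  rw [← Submodule.coe_inner, sharpD, InnerProductSpace.toDual_symm_apply]
  rfl

/-- The section `#α` of `D` corresponding to a section `α` of `D*`. -/
def sharpSecD {k : ℕ} (hD : IsSubbundle E F k D) (α : ∀ q, Dual ℝ (D q))
    (hα : IsSmoothDualSec E F D α) : SecD E F D :=
  ⟨⟨fun q => (sharpD D (α q) : A q), fun q => by
    obtain ⟨u, w, h⟩ := exists_projection_frame hD q
    -- Since P fixes #α and ⟨w_i, #α⟩ = α(w_i), locally #α = Σ α(w_i) u_i, with smooth coefficients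
    -- by hypothesis.
    have h1 : ContMDiffAt 𝓘(ℝ, E) (𝓘(ℝ, E).prod 𝓘(ℝ, F)) ∞
        (fun q' => (⟨q', ∑ i, α q' ((w i).eval q') • (u i).1 q'⟩ : TotalSpace F A)) q :=
      ContMDiffAt.sum_section fun i _ => (hα (w i) q).smul_section ((u i).1.contMDiff q)
    refine h1.congr_of_eventuallyEq ?_
    filter_upwards [h] with q' h'
    have h2 := h' (sharpD D (α q') : A q')
    rw [Submodule.starProjection_eq_self_iff.2 (sharpD D (α q')).2] at h2
    conv_lhs => rw [h2]
    congr! 3 with i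
    rw [real_inner_comm]
    exact inner_sharpD (α q') ((w i).eval q')⟩, fun q => (sharpD D (α q)).2⟩

/-- The orthogonal projector onto a subbundle is a smooth map. -/
theorem contMDiff_projD {k : ℕ} (hD : IsSubbundle E F k D) :
    ContMDiff (𝓘(ℝ, E).prod 𝓘(ℝ, F)) (𝓘(ℝ, E).prod 𝓘(ℝ, F)) ∞ (projD F D) := by
  intro a
  have hπ : ContMDiff (𝓘(ℝ, E).prod 𝓘(ℝ, F)) 𝓘(ℝ, E) ∞ (TotalSpace.proj : TotalSpace F A → Q) :=
    contMDiff_proj A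
  obtain ⟨u, w, h⟩ := exists_projection_frame hD a.1
  rw [contMDiffAt_totalSpace]
  refine ⟨hπ a, ?_⟩
  let e := trivializationAt F A a.1
  have he : a.1 ∈ e.baseSet := FiberBundle.mem_baseSet_trivializationAt F A a.1
  have hu : ∀ i, ContMDiffAt (𝓘(ℝ, E).prod 𝓘(ℝ, F)) 𝓘(ℝ, F) ∞
      (fun b : TotalSpace F A => (e ⟨b.1, (u i).1 b.1⟩).2) a := fun i =>
    ((contMDiffAt_section (IB := 𝓘(ℝ, E)) a.1).1 ((u i).1.contMDiff a.1)).comp a (hπ a)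
  have hw : ∀ i, ContMDiffAt (𝓘(ℝ, E).prod 𝓘(ℝ, F)) 𝓘(ℝ, ℝ) ∞
      (fun b : TotalSpace F A => ⟪(w i).1 b.1, b.2⟫_ℝ) a := fun i =>
    ContMDiffAt.inner_bundle (b := fun b : TotalSpace F A => b.1)
      (((w i).1.contMDiff a.1).comp a (hπ a)) contMDiffAt_id
  have hsum : ContMDiffAt (𝓘(ℝ, E).prod 𝓘(ℝ, F)) 𝓘(ℝ, F) ∞
      (fun b : TotalSpace F A => ∑ i, ⟪(w i).1 b.1, b.2⟫_ℝ • (e ⟨b.1, (u i).1 b.1⟩).2) a :=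
    contMDiffAt_finsetSum fun i _ => (hw i).smul (hu i)
  refine hsum.congr_of_eventuallyEq ?_
  filter_upwards [(hπ.continuous.tendsto a).eventually h,
    (hπ.continuous.tendsto a).eventually (e.open_baseSet.mem_nhds he)] with b hb hb'
  change (e ⟨b.1, (D b.1).starProjection b.2⟩).2 = _
  rw [hb b.2]
  simp only [← Trivialization.continuousLinearMapAt_apply_of_mem ℝ e hb', map_sum, map_smul]

/-- Smooth functions separate tangent vectors. -/
theorem tangent_ext {q : Q} {v w : TangentSpace 𝓘(ℝ, E) q}
    (h : ∀ f : Q → ℝ, ContMDiff 𝓘(ℝ, E) 𝓘(ℝ, ℝ) ∞ f →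
      mvfderiv 𝓘(ℝ, E) f q v = mvfderiv 𝓘(ℝ, E) f q w) : v = w := by
  have hs : (chartAt E q).source ∈ 𝓝 q := (chartAt E q).open_source.mem_nhds (mem_chart_source E q)
  obtain ⟨χ, hχ, -, hχ1, hχs⟩ := exists_bump (E := E) q hs
  -- A linear functional read in the chart at q, cut off by χ, is a global function with
  -- differential l at q.
  have key : ∀ (l : E →L[ℝ] ℝ), ∃ f : Q → ℝ, ContMDiff 𝓘(ℝ, E) 𝓘(ℝ, ℝ) ∞ f ∧
      ∀ v : TangentSpace 𝓘(ℝ, E) q, mvfderiv 𝓘(ℝ, E) f q v = l v := fun l => by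
    refine ⟨fun q' => χ q' * l (extChartAt 𝓘(ℝ, E) q q'), contMDiff_mul_of_tsupport hχ hχs
      fun q' hq' => l.contMDiff.contMDiffAt.comp q' (contMDiffAt_extChartAt' hq'), fun v => ?_⟩
    have h1 : (fun q' => χ q' * l (extChartAt 𝓘(ℝ, E) q q')) =ᶠ[𝓝 q]
        l ∘ extChartAt 𝓘(ℝ, E) q := by
      filter_upwards [hχ1] with q' h'
      simp [h']
    rw [mvfderiv_congr h1, mvfderiv_comp_apply q l.mdifferentiableAt
      (mdifferentiableAt_extChartAt (mem_chart_source E q)), mfderiv_extChartAt_self]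
    simp only [mvfderiv, l.mfderiv_eq]
    rfl
  by_contra hne
  obtain ⟨l, hl⟩ := SeparatingDual.exists_ne_zero (R := ℝ) (V := E) (x := (v - w : E))
    (sub_ne_zero.2 hne)
  obtain ⟨f, hf, hfl⟩ := key l
  have := h f hf
  rw [hfl, hfl] at this
  apply hl
  exact (map_sub l (v : E) (w : E)).trans (sub_eq_zero.2 this)

theorem nhBracket_basic_hat (S : LieAlgebroid E F A) (f : Q → ℝ) (X : SecD E F D) (q : Q)
    (ν : Dual ℝ (D q)) :
    nhBracket D S (fun ν' => f ν'.1) (hat X) ⟨q, ν⟩ =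
      mvfderiv 𝓘(ℝ, E) f q (S.anchor q (X.1 q)) :=
  poissonBracket_basic_linear S f (hat X ∘ restrictDual D) X.1 (fun _ => rfl)
    (projDual D ⟨q, ν⟩)

theorem nhBracket_hat_hat (S : LieAlgebroid E F A) (X Y : SecD E F D) (q : Q)
    (ν : Dual ℝ (D q)) :
    nhBracket D S (hat X) (hat Y) ⟨q, ν⟩ =
      -ν ((D q).orthogonalProjectionOnto (S.bracket X.1 Y.1 q)) :=
  poissonBracket_linear S (hat X ∘ restrictDual D) (hat Y ∘ restrictDual D) X.1 Y.1
    (fun _ => rfl) (fun _ => rfl) (projDual D ⟨q, ν⟩)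

/-- The restriction of ρ_A to D satisfies the condition behind the choice. It is the only solution,
because some section of D passes through a and smooth functions separate tangent vectors. -/
theorem anchorD_eq (S : LieAlgebroid E F A) {k : ℕ} (hD : IsSubbundle E F k D) (q : Q) (a : D q) :
    anchorD D S q a = S.anchor q a := by
  have hex : ∃ v : TangentSpace 𝓘(ℝ, E) q,
      ∀ X : SecD E F D, X.eval q = a → ∀ f : Q → ℝ, ContMDiff 𝓘(ℝ, E) 𝓘(ℝ, ℝ) ∞ f →
        ∀ ν : Dual ℝ (D q),
          mvfderiv 𝓘(ℝ, E) f q v = nhBracket D S (fun ν' => f ν'.1) (hat X) ⟨q, ν⟩ := by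
    refine ⟨S.anchor q a, fun X hX f _ ν => ?_⟩
    rw [nhBracket_basic_hat, ← hX]
    rfl
  have h := Classical.epsilon_spec hex
  obtain ⟨X, hX⟩ := exists_secD hD a
  refine tangent_ext fun f hf => ?_
  have h1 := h X hX f hf 0
  rw [nhBracket_basic_hat] at h1
  have h2 : X.1 q = a := congrArg Subtype.val hX
  rw [h2] at h1
  exact h1

/-- Evaluating at P*ν pairs ν with the projection of the ambient bracket, and functionals on D_q
separate its vectors. -/
theorem bracketD_eq (S : LieAlgebroid E F A) (X Y : SecD E F D) (q : Q) :
    bracketD D S X Y q = (D q).orthogonalProjectionOnto (S.bracket X.1 Y.1 q) := by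
  have hex : ∃ w : D q, ∀ ν : Dual ℝ (D q), ν w = -nhBracket D S (hat X) (hat Y) ⟨q, ν⟩ :=
    ⟨_, fun ν => by rw [nhBracket_hat_hat, neg_neg]⟩
  have h := Classical.epsilon_spec hex
  refine (Module.forall_dual_apply_eq_zero_iff ℝ _).1 (fun ν => ?_) |> sub_eq_zero.1
  rw [map_sub, sub_eq_zero]
  refine (h ν).trans ?_
  rw [nhBracket_hat_hat, neg_neg]

theorem dFun_eq (S : LieAlgebroid E F A) {k : ℕ} (hD : IsSubbundle E F k D) (f : Q → ℝ) (q : Q)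
    (a : D q) : dFun D S f q a = mvfderiv 𝓘(ℝ, E) f q (S.anchor q a) := by
  rw [dFun, anchorD_eq S hD]

/-- The almost differential of `α` in terms of the section `#α`. -/
theorem dForm_eq (S : LieAlgebroid E F A) {k : ℕ} (hD : IsSubbundle E F k D)
    (α : ∀ q, Dual ℝ (D q)) (hα : IsSmoothDualSec E F D α) (X Y : SecD E F D) (q : Q) :
    dForm D S α X Y q =
      mvfderiv 𝓘(ℝ, E) (fun q' => ⟪(sharpSecD hD α hα).1 q', Y.1 q'⟫_ℝ) q (S.anchor q (X.1 q))
      - mvfderiv 𝓘(ℝ, E) (fun q' => ⟪(sharpSecD hD α hα).1 q', X.1 q'⟫_ℝ) q (S.anchor q (Y.1 q))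
      - ⟪(sharpSecD hD α hα).1 q, S.bracket X.1 Y.1 q⟫_ℝ := by
  have h1 : ∀ (Z : SecD E F D) q', α q' (Z.eval q') = ⟪(sharpSecD hD α hα).1 q', Z.1 q'⟫_ℝ :=
    fun Z q' => (inner_sharpD (α q') (Z.eval q')).symm
  have h2 : α q (bracketD D S X Y q) = ⟪(sharpSecD hD α hα).1 q, S.bracket X.1 Y.1 q⟫_ℝ := by
    rw [bracketD_eq, ← inner_sharpD]
    change ⟪_, (D q).starProjection _⟫_ℝ = _
    -- P is self-adjoint and fixes #α, so the projector drops out and the ambient bracket remains.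
    rw [← Submodule.inner_starProjection_left_eq_right, Submodule.starProjection_eq_self_iff.2 (sharpD D (α q)).2]
    rfl
  rw [dForm, dFun_eq S hD, dFun_eq S hD, h2]
  simp only [h1]
  rfl

end Subbundle

/-! ### Transport of tangent vectors between equal base points -/

section TangentCast

variable {E₁ H₁ M₁ : Type*} [NormedAddCommGroup E₁] [NormedSpace ℝ E₁] [TopologicalSpace H₁]
  {I₁ : ModelWithCorners ℝ E₁ H₁} [TopologicalSpace M₁] [ChartedSpace H₁ M₁]
  {E₂ H₂ M₂ : Type*} [NormedAddCommGroup E₂] [NormedSpace ℝ E₂] [TopologicalSpace H₂]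
  {I₂ : ModelWithCorners ℝ E₂ H₂} [TopologicalSpace M₂] [ChartedSpace H₂ M₂]

theorem tangentCast_trans {x y z : M₁} (h : x = y) (h' : y = z) (v : TangentSpace I₁ x) :
    tangentCast h' (tangentCast h v) = tangentCast (h.trans h') v := by
  subst h; subst h'; rfl

theorem tangentCast_sub {x y : M₁} (h : x = y) (v w : TangentSpace I₁ x) :
    tangentCast h (v - w) = tangentCast h v - tangentCast h w := by
  subst h; rfl

theorem mvfderiv_tangentCast {x y : M₁} (h : x = y) (v : TangentSpace I₁ x) (g : M₁ → ℝ) :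
    mvfderiv I₁ g y (tangentCast h v) = mvfderiv I₁ g x v := by
  subst h; rfl

theorem mfderiv_tangentCast {x y : M₁} (h : x = y) (v : TangentSpace I₁ x) (g : M₁ → M₂) :
    mfderiv I₁ I₂ g y (tangentCast h v) = tangentCast (congrArg g h) (mfderiv I₁ I₂ g x v) := by
  subst h; rfl

theorem tangentCast_mfderiv_congr {f g : M₁ → M₂} (h : f = g) {x : M₁} {y : M₂} (hf : f x = y)
    (hg : g x = y) (v : TangentSpace I₁ x) :
    tangentCast hf (mfderiv I₁ I₂ f x v) = tangentCast hg (mfderiv I₁ I₂ g x v) := by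
  subst h; rfl

end TangentCast

/-! ### Tangent vectors of the total space and vertical lifts -/

/-- The pairing with a section of `A`, as a fibrewise linear function on `A`. -/
def pairing (Z : Sec E F A) (b : TotalSpace F A) : ℝ := ⟪b.2, Z b.1⟫_ℝ

section TotalSpace

variable [IsContMDiffRiemannianBundle 𝓘(ℝ, E) ∞ F A]

theorem mdifferentiableAt_pairing (Z : Sec E F A) (a : TotalSpace F A) :
    MDifferentiableAt (𝓘(ℝ, E).prod 𝓘(ℝ, F)) 𝓘(ℝ, ℝ) (pairing Z) a := by
  have hπ : ContMDiff (𝓘(ℝ, E).prod 𝓘(ℝ, F)) 𝓘(ℝ, E) ∞ (TotalSpace.proj : TotalSpace F A → Q) :=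
    contMDiff_proj A
  have : ContMDiffAt (𝓘(ℝ, E).prod 𝓘(ℝ, F)) 𝓘(ℝ, ℝ) ∞ (pairing Z) a :=
    ContMDiffAt.inner_bundle (b := fun b : TotalSpace F A => b.1)
      contMDiffAt_id ((Z.contMDiff a.1).comp a (hπ a))
  exact this.mdifferentiableAt (by simp)

/-- The derivative of the pairing with `Z` along the image of a tangent vector under a section. -/
theorem mvfderiv_pairing_section (Z X : Sec E F A) (q : Q) (v : TangentSpace 𝓘(ℝ, E) q) :
    mvfderiv (𝓘(ℝ, E).prod 𝓘(ℝ, F)) (pairing Z) (⟨q, X q⟩ : TotalSpace F A)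
      (mfderiv 𝓘(ℝ, E) (𝓘(ℝ, E).prod 𝓘(ℝ, F)) (fun q' => (⟨q', X q'⟩ : TotalSpace F A)) q v) =
      mvfderiv 𝓘(ℝ, E) (fun q' => ⟪X q', Z q'⟫_ℝ) q v :=
  (mvfderiv_comp_apply q (mdifferentiableAt_pairing Z _) X.mdifferentiableAt v).symm

theorem mfderiv_proj_section (X : Sec E F A) (q : Q) (v : TangentSpace 𝓘(ℝ, E) q) :
    mfderiv (𝓘(ℝ, E).prod 𝓘(ℝ, F)) 𝓘(ℝ, E) (TotalSpace.proj : TotalSpace F A → Q) ⟨q, X q⟩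
      (mfderiv 𝓘(ℝ, E) (𝓘(ℝ, E).prod 𝓘(ℝ, F)) (fun q' => (⟨q', X q'⟩ : TotalSpace F A)) q v) =
      v := by
  have h := mfderiv_comp_apply (f := fun q' => (⟨q', X q'⟩ : TotalSpace F A)) q
    (mdifferentiableAt_proj (IB := 𝓘(ℝ, E)) A) X.mdifferentiableAt v
  refine h.symm.trans ?_
  have : (TotalSpace.proj ∘ fun q' => (⟨q', X q'⟩ : TotalSpace F A)) = id := rfl
  rw [this, mfderiv_id]
  rfl

/-- The curve `t ↦ a + t w` in a fibre, in the trivialization at its base point. -/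
theorem trivializationAt_line (a : TotalSpace F A) (w : A a.1) (t : ℝ) :
    (trivializationAt F A a.1 ⟨a.1, a.2 + t • w⟩).2 =
      (trivializationAt F A a.1 a).2 + t • (trivializationAt F A a.1 ⟨a.1, w⟩).2 := by
  have he : a.1 ∈ (trivializationAt F A a.1).baseSet :=
    FiberBundle.mem_baseSet_trivializationAt F A a.1
  have h := fun x => Trivialization.continuousLinearMapAt_apply_of_mem ℝ
    (trivializationAt F A a.1) he x
  rw [← h, map_add, map_smul, h, h]

theorem mdifferentiableAt_line (a : TotalSpace F A) (w : A a.1) (t : ℝ) :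
    MDifferentiableAt 𝓘(ℝ, ℝ) (𝓘(ℝ, E).prod 𝓘(ℝ, F))
      (fun t : ℝ => (⟨a.1, a.2 + t • w⟩ : TotalSpace F A)) t := by
  rw [mdifferentiableAt_totalSpace]
  refine ⟨mdifferentiableAt_const, ?_⟩
  simp only [trivializationAt_line]
  rw [mdifferentiableAt_iff_differentiableAt]
  fun_prop

theorem mvfderiv_pairing_vlift (Z : Sec E F A) (a : TotalSpace F A) (w : A a.1) :
    mvfderiv (𝓘(ℝ, E).prod 𝓘(ℝ, F)) (pairing Z) a (vlift E F a w) = ⟪w, Z a.1⟫_ℝ := by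
  rw [vlift, mvfderiv_tangentCast]
  have h := mvfderiv_comp_apply (I := 𝓘(ℝ, E).prod 𝓘(ℝ, F)) (I' := 𝓘(ℝ, ℝ))
    (f := fun t : ℝ => (⟨a.1, a.2 + t • w⟩ : TotalSpace F A)) (0 : ℝ)
    (mdifferentiableAt_pairing Z _) (mdifferentiableAt_line a w 0) (1 : ℝ)
  refine h.symm.trans ?_
  have h1 : (pairing Z ∘ fun t : ℝ => (⟨a.1, a.2 + t • w⟩ : TotalSpace F A)) =
      fun t => ⟪a.2, Z a.1⟫_ℝ + t * ⟪w, Z a.1⟫_ℝ := by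
    funext t
    simp [pairing, inner_add_left, inner_smul_left]
  rw [h1]
  have h2 : HasDerivAt (fun t : ℝ => ⟪a.2, Z a.1⟫_ℝ + t * ⟪w, Z a.1⟫_ℝ) ⟪w, Z a.1⟫_ℝ 0 := by
    simpa using ((hasDerivAt_id (0 : ℝ)).mul_const ⟪w, Z a.1⟫_ℝ).const_add ⟪a.2, Z a.1⟫_ℝ
  simp only [mvfderiv, mfderiv_eq_fderiv]
  exact h2.deriv

theorem mfderiv_proj_vlift (a : TotalSpace F A) (w : A a.1) :
    mfderiv (𝓘(ℝ, E).prod 𝓘(ℝ, F)) 𝓘(ℝ, E) (TotalSpace.proj : TotalSpace F A → Q) a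
      (vlift E F a w) = 0 := by
  rw [vlift, mfderiv_tangentCast]
  have h := mfderiv_comp_apply (I := 𝓘(ℝ, ℝ)) (I' := 𝓘(ℝ, E).prod 𝓘(ℝ, F)) (I'' := 𝓘(ℝ, E))
    (f := fun t : ℝ => (⟨a.1, a.2 + t • w⟩ : TotalSpace F A)) (0 : ℝ)
    (mdifferentiableAt_proj (IB := 𝓘(ℝ, E)) A) (mdifferentiableAt_line a w 0) (1 : ℝ)
  rw [← h]
  have h1 : (TotalSpace.proj ∘ fun t : ℝ => (⟨a.1, a.2 + t • w⟩ : TotalSpace F A)) =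
      fun _ => a.1 := rfl
  rw [h1, mfderiv_const]
  rfl

theorem mdifferentiableAt_trivializationAt_snd (a : TotalSpace F A) :
    MDifferentiableAt (𝓘(ℝ, E).prod 𝓘(ℝ, F)) 𝓘(ℝ, F)
      (fun b : TotalSpace F A => (trivializationAt F A a.1 b).2) a :=
  ((mdifferentiableAt_totalSpace 𝓘(ℝ, E) id).1 mdifferentiableAt_id).2

theorem mfderiv_trivializationAt_snd_vlift (a : TotalSpace F A) (w : A a.1) :
    mfderiv (𝓘(ℝ, E).prod 𝓘(ℝ, F)) 𝓘(ℝ, F)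
      (fun b : TotalSpace F A => (trivializationAt F A a.1 b).2) a (vlift E F a w) =
      (trivializationAt F A a.1 ⟨a.1, w⟩).2 := by
  have h0 : (⟨a.1, a.2 + (0 : ℝ) • w⟩ : TotalSpace F A) = a := by simp
  have h := mfderiv_comp_apply_of_eq (I := 𝓘(ℝ, ℝ)) (I' := 𝓘(ℝ, E).prod 𝓘(ℝ, F))
    (I'' := 𝓘(ℝ, F))
    (f := fun t : ℝ => (⟨a.1, a.2 + t • w⟩ : TotalSpace F A)) (0 : ℝ)
    (mdifferentiableAt_trivializationAt_snd (E := E) a) (mdifferentiableAt_line a w 0) h0 (1 : ℝ)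
  have hc : ∀ {x : TotalSpace F A} (h : x = a) (v : TangentSpace (𝓘(ℝ, E).prod 𝓘(ℝ, F)) x),
      mfderiv (𝓘(ℝ, E).prod 𝓘(ℝ, F)) 𝓘(ℝ, F)
        (fun b : TotalSpace F A => (trivializationAt F A a.1 b).2) a (tangentCast h v) =
      mfderiv (𝓘(ℝ, E).prod 𝓘(ℝ, F)) 𝓘(ℝ, F)
        (fun b : TotalSpace F A => (trivializationAt F A a.1 b).2) a v := by
    intro x h v; subst h; rfl
  rw [vlift, hc]
  refine h.symm.trans ?_
  have h1 : ((fun b : TotalSpace F A => (trivializationAt F A a.1 b).2) ∘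
      fun t : ℝ => (⟨a.1, a.2 + t • w⟩ : TotalSpace F A)) =
      fun t => (trivializationAt F A a.1 a).2 + t • (trivializationAt F A a.1 ⟨a.1, w⟩).2 :=
    funext fun t => trivializationAt_line a w t
  rw [h1]
  have h2 : HasDerivAt (fun t : ℝ => (trivializationAt F A a.1 a).2 +
      t • (trivializationAt F A a.1 ⟨a.1, w⟩).2) (trivializationAt F A a.1 ⟨a.1, w⟩).2 0 := by
    simpa using ((hasDerivAt_id (0 : ℝ)).smul_const
      (trivializationAt F A a.1 ⟨a.1, w⟩).2).const_add (trivializationAt F A a.1 a).2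
  rw [mfderiv_eq_fderiv]
  exact h2.deriv

/-- A tangent vector of `A` is determined by its projection to `Q` and its fibre component. -/
theorem tangent_totalSpace_ext {a : TotalSpace F A}
    {v : TangentSpace (𝓘(ℝ, E).prod 𝓘(ℝ, F)) a}
    (h1 : mfderiv (𝓘(ℝ, E).prod 𝓘(ℝ, F)) 𝓘(ℝ, E) (TotalSpace.proj : TotalSpace F A → Q) a v = 0)
    (h2 : mfderiv (𝓘(ℝ, E).prod 𝓘(ℝ, F)) 𝓘(ℝ, F)
      (fun b : TotalSpace F A => (trivializationAt F A a.1 b).2) a v = 0) : v = 0 := by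
  have : ContMDiffVectorBundle 1 F A 𝓘(ℝ, E) := ContMDiffVectorBundle.of_le (n := ∞) (by simp)
  have : IsManifold (𝓘(ℝ, E).prod 𝓘(ℝ, F)) 1 (TotalSpace F A) :=
    Bundle.TotalSpace.isManifold F A
  have hπ := (FiberBundle.continuous_proj F A).tendsto a
  -- Near a the chart of the total space is the chart of Q paired with the fibre coordinate; its
  -- derivative at a is the identity, so these two factors see both components of v.
  have he : ∀ᶠ b in 𝓝 a, extChartAt (𝓘(ℝ, E).prod 𝓘(ℝ, F)) a b =
      (extChartAt 𝓘(ℝ, E) a.1 b.1, (trivializationAt F A a.1 b).2) := by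
    filter_upwards [hπ.eventually ((trivializationAt F A a.1).open_baseSet.mem_nhds
      (FiberBundle.mem_baseSet_trivializationAt F A a.1))] with b hb
    rw [FiberBundle.extChartAt]
    simp only [PartialEquiv.coe_trans, Function.comp_apply, PartialEquiv.prod_coe,
      PartialEquiv.refl_coe, id_eq]
    congr 2
    exact (trivializationAt F A a.1).coe_fst' hb
  have hd := mdifferentiableAt_extChartAt (I := 𝓘(ℝ, E).prod 𝓘(ℝ, F)) (mem_chart_source _ a)
  have hid := mfderiv_extChartAt_self (I := 𝓘(ℝ, E).prod 𝓘(ℝ, F)) (x := a)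
  have hfst := mfderiv_comp_apply (I := 𝓘(ℝ, E).prod 𝓘(ℝ, F)) (I' := 𝓘(ℝ, E × F))
    (I'' := 𝓘(ℝ, E)) a (ContinuousLinearMap.fst ℝ E F).mdifferentiableAt hd v
  have hsnd := mfderiv_comp_apply (I := 𝓘(ℝ, E).prod 𝓘(ℝ, F)) (I' := 𝓘(ℝ, E × F))
    (I'' := 𝓘(ℝ, F)) a (ContinuousLinearMap.snd ℝ E F).mdifferentiableAt hd v
  rw [ContinuousLinearMap.mfderiv_eq, hid] at hfst hsnd
  have hfst' : (ContinuousLinearMap.fst ℝ E F) ∘ extChartAt (𝓘(ℝ, E).prod 𝓘(ℝ, F)) a =ᶠ[𝓝 a]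
      extChartAt 𝓘(ℝ, E) a.1 ∘ TotalSpace.proj := he.mono fun b hb => by
    simp only [Function.comp_apply, hb]
    rfl
  have hsnd' : (ContinuousLinearMap.snd ℝ E F) ∘ extChartAt (𝓘(ℝ, E).prod 𝓘(ℝ, F)) a =ᶠ[𝓝 a]
      fun b => (trivializationAt F A a.1 b).2 := he.mono fun b hb => by
    simp only [Function.comp_apply, hb]
    rfl
  have h3 : mfderiv (𝓘(ℝ, E).prod 𝓘(ℝ, F)) 𝓘(ℝ, E)
      (extChartAt 𝓘(ℝ, E) a.1 ∘ (TotalSpace.proj : TotalSpace F A → Q)) a v = 0 := by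
    rw [mfderiv_comp_apply a
      (mdifferentiableAt_extChartAt (I := 𝓘(ℝ, E)) (mem_chart_source E a.1))
      (mdifferentiableAt_proj (IB := 𝓘(ℝ, E)) A), h1, map_zero]
  rw [hfst'.mfderiv_eq] at hfst
  rw [hsnd'.mfderiv_eq] at hsnd
  exact Prod.ext (hfst.symm.trans h3) (hsnd.symm.trans h2)

/-- Vertical tangent vectors are vertical lifts. -/
theorem exists_eq_vlift {a : TotalSpace F A} {v : TangentSpace (𝓘(ℝ, E).prod 𝓘(ℝ, F)) a}
    (h : mfderiv (𝓘(ℝ, E).prod 𝓘(ℝ, F)) 𝓘(ℝ, E) (TotalSpace.proj : TotalSpace F A → Q) a v = 0) :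
    ∃ x : A a.1, v = vlift E F a x := by
  have he : a.1 ∈ (trivializationAt F A a.1).baseSet :=
    FiberBundle.mem_baseSet_trivializationAt F A a.1
  let f : F := mfderiv (𝓘(ℝ, E).prod 𝓘(ℝ, F)) 𝓘(ℝ, F)
      (fun b : TotalSpace F A => (trivializationAt F A a.1 b).2) a v
  refine ⟨(trivializationAt F A a.1).symm a.1 f, sub_eq_zero.1 (tangent_totalSpace_ext ?_ ?_)⟩
  · rw [map_sub, h, mfderiv_proj_vlift, sub_zero]
  · rw [map_sub, mfderiv_trivializationAt_snd_vlift, Trivialization.apply_mk_symm _ he]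
    exact sub_self _

theorem vlift_eq_zero_iff {a : TotalSpace F A} {w : A a.1} : vlift E F a w = 0 ↔ w = 0 := by
  constructor
  · intro h
    -- Pairing with a section through w itself gives |w|² = 0.
    have h1 := mvfderiv_pairing_vlift (secThrough E F w) a w
    rw [h, map_zero, secThrough_apply] at h1
    exact inner_self_eq_zero.1 h1.symm
  · rintro rfl
    refine tangent_totalSpace_ext (mfderiv_proj_vlift a 0) ?_
    rw [mfderiv_trivializationAt_snd_vlift]
    exact (Trivialization.continuousLinearMapAt_apply_of_mem ℝ (trivializationAt F A a.1)
      (FiberBundle.mem_baseSet_trivializationAt F A a.1) 0).symm.trans (map_zero _)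

end TotalSpace

/-! ### Levi-Civita connection, geodesic flow and constrained dynamics -/

section Dynamics

variable [IsContMDiffRiemannianBundle 𝓘(ℝ, E) ∞ F A]

theorem bracket_fsmul_left (S : LieAlgebroid E F A) (X Y : Sec E F A) (f : Q → ℝ)
    (hf : ContMDiff 𝓘(ℝ, E) 𝓘(ℝ, ℝ) ∞ f) (q : Q) :
    S.bracket (fsmul f hf Y) X q =
      f q • S.bracket Y X q - mvfderiv 𝓘(ℝ, E) f q (S.anchor q (X q)) • Y q := by
  rw [bracket_skew_apply, bracket_fsmul_right, bracket_skew_apply S Y X]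
  module

theorem bracket_self_apply (S : LieAlgebroid E F A) (X : Sec E F A) (q : Q) :
    S.bracket X X q = 0 := by
  have h : (2 : ℝ) • S.bracket X X q = 0 := by
    rw [two_smul]
    nth_rewrite 1 [bracket_skew_apply]
    exact neg_add_cancel _
  simpa using h

/-- A tensorial operation with real values is the inner product with a vector. -/
theorem IsTensorialAt.exists_inner {T : Sec E F A → ℝ} {q : Q} (hT : IsTensorialAt T q) :
    ∃ w : A q, ∀ Z : Sec E F A, ⟪w, Z q⟫_ℝ = T Z := by
  let l : A q →ₗ[ℝ] ℝ :=
    { toFun := fun a => T (secThrough E F a)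
      map_add' := fun a b => by
        rw [← hT.add]
        exact hT.congr (by simp [secThrough_apply])
      map_smul' := fun c a => by
        have := hT.smul (fun _ => c) contMDiff_const (secThrough E F a)
        rw [RingHom.id_apply, smul_eq_mul, ← this]
        exact hT.congr (by simp [secThrough_apply]) }
  refine ⟨(InnerProductSpace.toDual ℝ (A q)).symm (LinearMap.toContinuousLinearMap l), fun Z => ?_⟩
  rw [InnerProductSpace.toDual_symm_apply]
  exact hT.congr (secThrough_apply E F _)

theorem mvfderiv_inner_add_right (X Y Z : Sec E F A) (q : Q) (v : TangentSpace 𝓘(ℝ, E) q) :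
    mvfderiv 𝓘(ℝ, E) (fun q' => ⟪X q', (Y + Z) q'⟫_ℝ) q v =
      mvfderiv 𝓘(ℝ, E) (fun q' => ⟪X q', Y q'⟫_ℝ) q v +
      mvfderiv 𝓘(ℝ, E) (fun q' => ⟪X q', Z q'⟫_ℝ) q v := by
  rw [← mvfderiv_add_apply (mdifferentiableAt_inner X Y q) (mdifferentiableAt_inner X Z q)]
  simp only [ContMDiffSection.coe_add, Pi.add_apply, inner_add_right]

theorem mvfderiv_inner_fsmul_right (X Y : Sec E F A) (f : Q → ℝ)
    (hf : ContMDiff 𝓘(ℝ, E) 𝓘(ℝ, ℝ) ∞ f) (q : Q) (v : TangentSpace 𝓘(ℝ, E) q) :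
    mvfderiv 𝓘(ℝ, E) (fun q' => ⟪X q', fsmul f hf Y q'⟫_ℝ) q v =
      f q * mvfderiv 𝓘(ℝ, E) (fun q' => ⟪X q', Y q'⟫_ℝ) q v +
      ⟪X q, Y q⟫_ℝ * mvfderiv 𝓘(ℝ, E) f q v := by
  rw [← mvfderiv_mul_apply (hf.mdifferentiable (by simp) q) (mdifferentiableAt_inner X Y q)]
  simp only [fsmul_apply, inner_smul_right]

theorem mvfderiv_inner_comm (X Y : Sec E F A) (q : Q) (v : TangentSpace 𝓘(ℝ, E) q) :
    mvfderiv 𝓘(ℝ, E) (fun q' => ⟪X q', Y q'⟫_ℝ) q v =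
      mvfderiv 𝓘(ℝ, E) (fun q' => ⟪Y q', X q'⟫_ℝ) q v := by
  simp only [real_inner_comm]

/-- On the diagonal, the terms ρ(X)(f)⟨X, Z⟩ from the two derivatives along X cancel those from the
two brackets [fZ, X]. The diagonal is all that the geodesic flow uses. -/
theorem isTensorialAt_koszul (S : LieAlgebroid E F A) (X : Sec E F A) (q : Q) :
    IsTensorialAt (fun Z => koszul S X X Z q) q where
  add Y Z := by
    simp only [koszul, mvfderiv_inner_add_right, bracket_self_apply, inner_zero_right]
    simp only [ContMDiffSection.coe_add, Pi.add_apply, map_add, LinearMap.add_apply,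
      inner_add_right]
    ring
  smul f hf Z := by
    simp only [koszul, mvfderiv_inner_fsmul_right X Z f hf]
    simp only [bracket_self_apply, inner_zero_right, bracket_fsmul_left, fsmul_apply, map_smul, inner_sub_right, inner_smul_right, smul_eq_mul]
    ring

theorem leviCivita_spec (S : LieAlgebroid E F A) (X Z : Sec E F A) (q : Q) :
    2 * ⟪leviCivita S X X q, Z q⟫_ℝ = koszul S X X Z q := by
  obtain ⟨w, hw⟩ := (isTensorialAt_koszul S X q).exists_inner
  have hex : ∃ w : A q, ∀ Z : Sec E F A, 2 * ⟪w, Z q⟫_ℝ = koszul S X X Z q := by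
    refine ⟨(1 / 2 : ℝ) • w, fun Z => ?_⟩
    rw [inner_smul_left, hw]
    simp
  exact Classical.epsilon_spec hex Z

/-- Replacing W by fW produces ρ(Z)(f)⟨U, W⟩ in both terms, and the two cancel. -/
theorem isTensorialAt_inner_sub_bracket (S : LieAlgebroid E F A) (Z U : Sec E F A) (q : Q) :
    IsTensorialAt (fun W => mvfderiv 𝓘(ℝ, E) (fun q' => ⟪U q', W q'⟫_ℝ) q (S.anchor q (Z q)) -
      ⟪U q, S.bracket Z W q⟫_ℝ) q where
  add X Y := by
    simp only [mvfderiv_inner_add_right]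
    simp only [ContMDiffSection.coe_add, Pi.add_apply, map_add, inner_add_right]
    ring
  smul f hf X := by
    simp only [mvfderiv_inner_fsmul_right, bracket_fsmul_right, inner_add_right, inner_smul_right]
    ring

/-- The expression for the geodesic flow paired with `Z` depends only on the value of the
section. -/
theorem half_inner_sub_bracket_congr (S : LieAlgebroid E F A) (Z X Y : Sec E F A) (q : Q)
    (h : X q = Y q) :
    (1 / 2) * mvfderiv 𝓘(ℝ, E) (fun q' => ⟪X q', X q'⟫_ℝ) q (S.anchor q (Z q)) -
      ⟪X q, S.bracket Z X q⟫_ℝ =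
    (1 / 2) * mvfderiv 𝓘(ℝ, E) (fun q' => ⟪Y q', Y q'⟫_ℝ) q (S.anchor q (Z q)) -
      ⟪Y q, S.bracket Z Y q⟫_ℝ := by
  -- Polarization: apply tensoriality with U = X + Y to W = X and W = Y. The mixed derivatives
  -- ρ(Z)⟨X, Y⟩ cancel, leaving twice the claim.
  have h1 := (isTensorialAt_inner_sub_bracket S Z (X + Y) q).congr h
  simp only [mvfderiv_inner_comm (X + Y), mvfderiv_inner_add_right] at h1
  simp only [ContMDiffSection.coe_add, Pi.add_apply, inner_add_left, ← h] at h1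
  have h2 := mvfderiv_inner_comm X Y q (S.anchor q (Z q))
  rw [← h]
  linarith

/-- By the Koszul formula, ρ(X)⟨X, Z⟩ cancels between TX(ρ(X)) and the connection term; what remains
depends only on X(q), so X may replace the chosen section. -/
theorem mvfderiv_pairing_geodesicFlow (S : LieAlgebroid E F A) (Z X : Sec E F A) (q : Q) :
    mvfderiv (𝓘(ℝ, E).prod 𝓘(ℝ, F)) (pairing Z) (⟨q, X q⟩ : TotalSpace F A)
      (geodesicFlow S ⟨q, X q⟩) =
    (1 / 2) * mvfderiv 𝓘(ℝ, E) (fun q' => ⟪X q', X q'⟫_ℝ) q (S.anchor q (Z q)) -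
      ⟪X q, S.bracket Z X q⟫_ℝ := by
  rw [half_inner_sub_bracket_congr S Z X (secThrough E F (X q)) q (secThrough_apply E F _).symm,
    geodesicFlow, map_sub, mvfderiv_tangentCast, mvfderiv_pairing_section, mvfderiv_pairing_vlift]
  have h := leviCivita_spec S (secThrough E F (X q)) Z q
  rw [koszul, bracket_self_apply, inner_zero_right] at h
  rw [secThrough_apply] at h ⊢
  linarith

theorem mfderiv_proj_geodesicFlow (S : LieAlgebroid E F A) (a : TotalSpace F A) :
    mfderiv (𝓘(ℝ, E).prod 𝓘(ℝ, F)) 𝓘(ℝ, E) (TotalSpace.proj : TotalSpace F A → Q) a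
      (geodesicFlow S a) = S.anchor a.1 a.2 := by
  rw [geodesicFlow, map_sub, mfderiv_proj_vlift, sub_zero, mfderiv_tangentCast,
    mfderiv_proj_section]
  rfl

theorem inner_grad (S : LieAlgebroid E F A) (V : Q → ℝ) (q : Q) (a : A q) :
    ⟪grad S V q, a⟫_ℝ = mvfderiv 𝓘(ℝ, E) V q (S.anchor q a) := by
  rw [grad, InnerProductSpace.toDual_symm_apply]
  rfl

/-- Along a section `X`, the Euler-Lagrange vector field differs from `TX ∘ ρ(X)` by a vertical
lift. -/
theorem exists_xiL_eq (S : LieAlgebroid E F A) (V : Q → ℝ) (X : Sec E F A) (q : Q) :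
    ∃ y : A q,
      xiL S V ⟨q, X q⟩ =
        mfderiv 𝓘(ℝ, E) (𝓘(ℝ, E).prod 𝓘(ℝ, F)) (fun q' => (⟨q', X q'⟩ : TotalSpace F A)) q
          (S.anchor q (X q)) - vlift E F ⟨q, X q⟩ y ∧
      ∀ Z : Sec E F A, ⟪y, Z q⟫_ℝ =
        mvfderiv 𝓘(ℝ, E) (fun q' => ⟪X q', Z q'⟫_ℝ) q (S.anchor q (X q))
        - (1 / 2) * mvfderiv 𝓘(ℝ, E) (fun q' => ⟪X q', X q'⟫_ℝ) q (S.anchor q (Z q))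
        + ⟪X q, S.bracket Z X q⟫_ℝ + mvfderiv 𝓘(ℝ, E) V q (S.anchor q (Z q)) := by
  -- Both fields project to ρ(X(q)), so their difference is vertical; pairing it with sections Z
  -- then identifies y.
  obtain ⟨y, hy⟩ := exists_eq_vlift (E := E) (a := (⟨q, X q⟩ : TotalSpace F A))
    (v := mfderiv 𝓘(ℝ, E) (𝓘(ℝ, E).prod 𝓘(ℝ, F)) (fun q' => (⟨q', X q'⟩ : TotalSpace F A)) q
      (S.anchor q (X q)) - xiL S V ⟨q, X q⟩) (by
    rw [map_sub, mfderiv_proj_section, xiL, map_sub, mfderiv_proj_vlift,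
      mfderiv_proj_geodesicFlow, sub_zero, sub_self])
  refine ⟨y, by rw [← hy]; abel, fun Z => ?_⟩
  have h1 := mvfderiv_pairing_vlift Z (⟨q, X q⟩ : TotalSpace F A) y
  rw [← hy, map_sub, mvfderiv_pairing_section, xiL, map_sub, mvfderiv_pairing_geodesicFlow,
    mvfderiv_pairing_vlift, inner_grad] at h1
  linarith

variable {D : ∀ q, Submodule ℝ (A q)}

theorem tangentCast_mfderiv_projD_section {k : ℕ} (hD : IsSubbundle E F k D) (X : SecD E F D)
    (q : Q) (h : projD F D ⟨q, X.1 q⟩ = ⟨q, X.1 q⟩) (v : TangentSpace 𝓘(ℝ, E) q) :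
    tangentCast h (mfderiv (𝓘(ℝ, E).prod 𝓘(ℝ, F)) (𝓘(ℝ, E).prod 𝓘(ℝ, F)) (projD F D) ⟨q, X.1 q⟩
      (mfderiv 𝓘(ℝ, E) (𝓘(ℝ, E).prod 𝓘(ℝ, F)) (fun q' => (⟨q', X.1 q'⟩ : TotalSpace F A)) q v)) =
    mfderiv 𝓘(ℝ, E) (𝓘(ℝ, E).prod 𝓘(ℝ, F)) (fun q' => (⟨q', X.1 q'⟩ : TotalSpace F A)) q v := by
  have h1 := mfderiv_comp_apply (f := fun q' => (⟨q', X.1 q'⟩ : TotalSpace F A)) q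
    ((contMDiff_projD hD).mdifferentiable (by simp) _) X.1.mdifferentiableAt v
  rw [← h1]
  -- A section of D satisfies P ∘ X = X, so TP fixes the image of TX.
  refine tangentCast_mfderiv_congr (g := fun q' => (⟨q', X.1 q'⟩ : TotalSpace F A))
    (funext fun q' => ?_) h rfl v
  simp only [projD, Function.comp_apply, Submodule.starProjection_eq_self_iff.2 (X.2 q')]

theorem tangentCast_mfderiv_projD_vlift {k : ℕ} (hD : IsSubbundle E F k D) (a : TotalSpace F A)
    (h : projD F D a = a) (y : A a.1) :
    tangentCast h (mfderiv (𝓘(ℝ, E).prod 𝓘(ℝ, F)) (𝓘(ℝ, E).prod 𝓘(ℝ, F)) (projD F D) a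
      (vlift E F a y)) = vlift E F a ((D a.1).starProjection y) := by
  have h0 : (D a.1).starProjection a.2 = a.2 := by
    have := h
    rcases a with ⟨q, a⟩
    simpa [projD, TotalSpace.mk_inj] using this
  rw [vlift, mfderiv_tangentCast, tangentCast_trans]
  have h1 := mfderiv_comp_apply (I := 𝓘(ℝ, ℝ)) (I' := 𝓘(ℝ, E).prod 𝓘(ℝ, F))
    (I'' := 𝓘(ℝ, E).prod 𝓘(ℝ, F))
    (f := fun t : ℝ => (⟨a.1, a.2 + t • y⟩ : TotalSpace F A)) (0 : ℝ)
    ((contMDiff_projD hD).mdifferentiable (by simp) _) (mdifferentiableAt_line a y 0) (1 : ℝ)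
  rw [← h1, vlift]
  -- P is linear on fibres and fixes a, so it carries the line a + ty to a + tP(y).
  refine tangentCast_mfderiv_congr (funext fun t => ?_) _ _ (1 : ℝ)
  simp only [projD, Function.comp_apply, map_add, map_smul, h0]

/-- Along `#α`, the constrained dynamics differs from `T(#α) ∘ ρ(#α)` by the vertical lift of the
gradient along `D` of the energy of `#α`. -/
theorem exists_xiLD_eq (S : LieAlgebroid E F A) (V : Q → ℝ) {k : ℕ} (hD : IsSubbundle E F k D)
    (X : SecD E F D) (q : Q) :
    ∃ y : A q, y ∈ D q ∧
      xiLD D S V ⟨q, X.1 q⟩ =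
        mfderiv 𝓘(ℝ, E) (𝓘(ℝ, E).prod 𝓘(ℝ, F)) (fun q' => (⟨q', X.1 q'⟩ : TotalSpace F A)) q
          (S.anchor q (X.1 q)) - vlift E F ⟨q, X.1 q⟩ y ∧
      ∀ Z : SecD E F D, ⟪y, Z.1 q⟫_ℝ =
        mvfderiv 𝓘(ℝ, E) (fun q' => ⟪X.1 q', Z.1 q'⟫_ℝ) q (S.anchor q (X.1 q))
        - (1 / 2) * mvfderiv 𝓘(ℝ, E) (fun q' => ⟪X.1 q', X.1 q'⟫_ℝ) q (S.anchor q (Z.1 q))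
        + ⟪X.1 q, S.bracket Z.1 X.1 q⟫_ℝ + mvfderiv 𝓘(ℝ, E) V q (S.anchor q (Z.1 q)) := by
  obtain ⟨y, hy, hyZ⟩ := exists_xiL_eq S V X.1 q
  have h : projD F D (⟨q, X.1 q⟩ : TotalSpace F A) = ⟨q, X.1 q⟩ := by
    simp only [projD, Submodule.starProjection_eq_self_iff.2 (X.2 q)]
  -- The constrained y is the projection of the unconstrained one; self-adjointness of P leaves its
  -- pairing with sections of D unchanged.
  refine ⟨(D q).starProjection y, Submodule.starProjection_apply_mem _ _, ?_, fun Z => ?_⟩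
  · rw [xiLD, dif_pos h, hy, map_sub, tangentCast_sub, tangentCast_mfderiv_projD_section hD,
      tangentCast_mfderiv_projD_vlift hD]
  · rw [Submodule.inner_starProjection_left_eq_right,
      Submodule.starProjection_eq_self_iff.2 (Z.2 q)]
    exact hyZ Z.1

/-- The kinetic term is quadratic along a + ta, so the Liouville field yields |#α|², and subtracting
L leaves kinetic plus potential energy. -/
theorem energyAlong_eq (V : Q → ℝ) (α : ∀ q, Dual ℝ (D q)) (q : Q) :
    energyAlong F D V α q = (1 / 2) * ⟪(sharpD D (α q) : A q), (sharpD D (α q) : A q)⟫_ℝ + V q := by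
  have h : ∀ t : ℝ, lagrangian F V (⟨q, (sharpD D (α q) : A q) + t • (sharpD D (α q) : A q)⟩ :
      TotalSpace F A) = (1 / 2) * ((1 + t) * (1 + t) *
        ⟪(sharpD D (α q) : A q), (sharpD D (α q) : A q)⟫_ℝ) - V q := fun t => by
    simp only [lagrangian, inner_add_left, inner_add_right, inner_smul_left, inner_smul_right,
      conj_trivial]
    ring
  have hd : HasDerivAt (fun t : ℝ => (1 / 2) * ((1 + t) * (1 + t) *
        ⟪(sharpD D (α q) : A q), (sharpD D (α q) : A q)⟫_ℝ) - V q)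
      ⟪(sharpD D (α q) : A q), (sharpD D (α q) : A q)⟫_ℝ 0 := by
    have h1 := (hasDerivAt_id (0 : ℝ)).const_add (1 : ℝ)
    have h2 := (((h1.mul h1).mul_const
      ⟪(sharpD D (α q) : A q), (sharpD D (α q) : A q)⟫_ℝ).const_mul (1 / 2 : ℝ)).sub_const (V q)
    refine h2.congr_deriv ?_
    simp only [id_eq]
    ring
  have h3 : energyAlong F D V α q = ⟪(sharpD D (α q) : A q), (sharpD D (α q) : A q)⟫_ℝ -
      lagrangian F V (⟨q, (sharpD D (α q) : A q)⟩ : TotalSpace F A) := by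
    rw [← hd.deriv, ← funext h]
    rfl
  rw [h3, lagrangian]
  ring

theorem contMDiff_energyAlong {V : Q → ℝ} (hV : ContMDiff 𝓘(ℝ, E) 𝓘(ℝ, ℝ) ∞ V) {k : ℕ}
    (hD : IsSubbundle E F k D) {α : ∀ q, Dual ℝ (D q)} (hα : IsSmoothDualSec E F D α) :
    ContMDiff 𝓘(ℝ, E) 𝓘(ℝ, ℝ) ∞ (energyAlong F D V α) := by
  have : energyAlong F D V α = fun q =>
      (1 / 2) * ⟪(sharpSecD hD α hα).1 q, (sharpSecD hD α hα).1 q⟫_ℝ + V q :=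
    funext fun q => energyAlong_eq V α q
  rw [this]
  exact (contMDiff_const.mul (contMDiff_inner _ _)).add hV

theorem mvfderiv_energyAlong {V : Q → ℝ} (hV : ContMDiff 𝓘(ℝ, E) 𝓘(ℝ, ℝ) ∞ V) {k : ℕ}
    (hD : IsSubbundle E F k D) {α : ∀ q, Dual ℝ (D q)} (hα : IsSmoothDualSec E F D α) (q : Q)
    (v : TangentSpace 𝓘(ℝ, E) q) :
    mvfderiv 𝓘(ℝ, E) (energyAlong F D V α) q v =
      (1 / 2) * mvfderiv 𝓘(ℝ, E)
        (fun q => ⟪(sharpSecD hD α hα).1 q, (sharpSecD hD α hα).1 q⟫_ℝ) q v +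
      mvfderiv 𝓘(ℝ, E) V q v := by
  have : energyAlong F D V α = fun q =>
      (1 / 2) * ⟪(sharpSecD hD α hα).1 q, (sharpSecD hD α hα).1 q⟫_ℝ + V q :=
    funext fun q => energyAlong_eq V α q
  have h1 := mdifferentiableAt_inner (sharpSecD hD α hα).1 (sharpSecD hD α hα).1 q
  have hc : MDifferentiableAt 𝓘(ℝ, E) 𝓘(ℝ, ℝ) (fun _ : Q => (1 / 2 : ℝ)) q :=
    mdifferentiableAt_const
  rw [this, mvfderiv_add_apply (f := fun q => (1 / 2) *
    ⟪(sharpSecD hD α hα).1 q, (sharpSecD hD α hα).1 q⟫_ℝ) (hc.mul h1) (hV.mdifferentiable (by simp) q),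
    mvfderiv_mul_apply hc h1, mvfderiv_const]
  simp

/-- For closed `α`, the constrained dynamics along `#α` and the derivative along `D` of the
energy. -/
theorem exists_xiLD_sharp (S : LieAlgebroid E F A) {V : Q → ℝ}
    (hV : ContMDiff 𝓘(ℝ, E) 𝓘(ℝ, ℝ) ∞ V) {k : ℕ} (hD : IsSubbundle E F k D)
    {α : ∀ q, Dual ℝ (D q)} (hα : IsSmoothDualSec E F D α)
    (hcocycle : ∀ (X Y : SecD E F D) (q : Q), dForm D S α X Y q = 0) (q : Q) :
    ∃ y : A q, y ∈ D q ∧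
      xiLD D S V (sharpSec F D α q) =
        mfderiv 𝓘(ℝ, E) (𝓘(ℝ, E).prod 𝓘(ℝ, F)) (sharpSec F D α) q
          (S.anchor q (sharpD D (α q) : A q)) - vlift E F (sharpSec F D α q) y ∧
      ∀ a : D q, ⟪y, (a : A q)⟫_ℝ = dFun D S (energyAlong F D V α) q a := by
  obtain ⟨y, hyD, hy, hyZ⟩ := exists_xiLD_eq S V hD (sharpSecD hD α hα) q
  refine ⟨y, hyD, hy, fun a => ?_⟩
  obtain ⟨Z, rfl⟩ := exists_secD hD a
  rw [dFun_eq S hD, mvfderiv_energyAlong hV hD hα]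
  have h1 := hyZ Z
  -- Closedness on #α and Z turns ρ(#α)⟨#α, Z⟩ + ⟨#α, [Z, #α]⟩ into ρ(Z)|#α|²; with the term -½
  -- ρ(Z)|#α|² this is the derivative of the kinetic energy.
  have h2 := hcocycle (sharpSecD hD α hα) Z q
  rw [dForm_eq S hD α hα, bracket_skew_apply S _ Z.1, inner_neg_right] at h2
  change ⟪y, Z.1 q⟫_ℝ = _ * mvfderiv 𝓘(ℝ, E) _ q (S.anchor q (Z.1 q)) +
    mvfderiv 𝓘(ℝ, E) V q (S.anchor q (Z.1 q))
  linarith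

end Dynamics

/-! ### Lifting integral curves: (i) ⇔ (ii) -/

section IntegralCurves

variable [IsContMDiffRiemannianBundle 𝓘(ℝ, E) ∞ F A] {D : ∀ q, Submodule ℝ (A q)}

theorem mdifferentiableAt_sharpSec {k : ℕ} (hD : IsSubbundle E F k D) {α : ∀ q, Dual ℝ (D q)}
    (hα : IsSmoothDualSec E F D α) (q : Q) :
    MDifferentiableAt 𝓘(ℝ, E) (𝓘(ℝ, E).prod 𝓘(ℝ, F)) (sharpSec F D α) q :=
  (sharpSecD hD α hα).1.mdifferentiableAt

/-- Projection to Q kills the vertical correction, so the base field is independent of V. -/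
theorem xiLDalpha_eq (S : LieAlgebroid E F A) (V : Q → ℝ) {k : ℕ} (hD : IsSubbundle E F k D)
    {α : ∀ q, Dual ℝ (D q)} (hα : IsSmoothDualSec E F D α) (q : Q) :
    xiLDalpha D S V α q = S.anchor q (sharpD D (α q) : A q) := by
  obtain ⟨y, -, hy, -⟩ := exists_xiLD_eq S V hD (sharpSecD hD α hα) q
  have h1 := mfderiv_proj_section (sharpSecD hD α hα).1 q
    (S.anchor q (sharpD D (α q) : A q))
  have h2 := mfderiv_proj_vlift (E := E) (⟨q, (sharpSecD hD α hα).1 q⟩ : TotalSpace F A) y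
  change mfderiv (𝓘(ℝ, E).prod 𝓘(ℝ, F)) 𝓘(ℝ, E) (TotalSpace.proj : TotalSpace F A → Q)
    (⟨q, (sharpSecD hD α hα).1 q⟩ : TotalSpace F A)
    (xiLD D S V (⟨q, (sharpSecD hD α hα).1 q⟩ : TotalSpace F A)) = _
  rw [hy, map_sub, h2, sub_zero]
  exact h1

/-- The lift by `#α` of an integral curve of `ξ_{(L,D)α}`. -/
theorem hasMFDerivWithinAt_sharpSec_comp (S : LieAlgebroid E F A) (V : Q → ℝ) {k : ℕ}
    (hD : IsSubbundle E F k D) {α : ∀ q, Dual ℝ (D q)} (hα : IsSmoothDualSec E F D α)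
    {c : ℝ → Q} {J : Set ℝ} (hc : IsMIntegralCurveOn c (xiLDalpha D S V α) J) {t : ℝ}
    (ht : t ∈ J) :
    HasMFDerivWithinAt 𝓘(ℝ, ℝ) (𝓘(ℝ, E).prod 𝓘(ℝ, F)) (fun t => sharpSec F D α (c t)) J t
      ((1 : ℝ →L[ℝ] ℝ).smulRight
        (mfderiv 𝓘(ℝ, E) (𝓘(ℝ, E).prod 𝓘(ℝ, F)) (sharpSec F D α) (c t)
          (S.anchor (c t) (sharpD D (α (c t)) : A (c t))))) := by
  have h := (mdifferentiableAt_sharpSec hD hα (c t)).hasMFDerivAt.comp_hasMFDerivWithinAt t (hc t ht)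
  have h2 : (mfderiv 𝓘(ℝ, E) (𝓘(ℝ, E).prod 𝓘(ℝ, F)) (sharpSec F D α) (c t)).comp
      ((1 : ℝ →L[ℝ] ℝ).smulRight (xiLDalpha D S V α (c t))) =
      (1 : ℝ →L[ℝ] ℝ).smulRight
        (mfderiv 𝓘(ℝ, E) (𝓘(ℝ, E).prod 𝓘(ℝ, F)) (sharpSec F D α) (c t)
          (S.anchor (c t) (sharpD D (α (c t)) : A (c t)))) := by
    rw [xiLDalpha_eq S V hD hα]
    refine ContinuousLinearMap.ext fun s => ?_
    exact (mfderiv 𝓘(ℝ, E) (𝓘(ℝ, E).prod 𝓘(ℝ, F)) (sharpSec F D α) (c t)).map_smul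
      ((1 : ℝ →L[ℝ] ℝ) s) _
  exact h2 ▸ h

/-- The integral curves of `ξ_{(L,D)α}` lift to solutions exactly if the energy of `#α` is
`d^D`-closed. -/
theorem liftsIntegralCurves_iff (S : LieAlgebroid E F A) {V : Q → ℝ}
    (hV : ContMDiff 𝓘(ℝ, E) 𝓘(ℝ, ℝ) ∞ V) {k : ℕ} (hD : IsSubbundle E F k D)
    {α : ∀ q, Dual ℝ (D q)} (hα : IsSmoothDualSec E F D α)
    (hcocycle : ∀ (X Y : SecD E F D) (q : Q), dForm D S α X Y q = 0) :
    LiftsIntegralCurves D S V α ↔ ∀ q a, dFun D S (energyAlong F D V α) q a = 0 := by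
  constructor
  · intro h q a
    have hv : ContMDiff 𝓘(ℝ, E) 𝓘(ℝ, E).tangent ∞
        (fun q => (⟨q, xiLDalpha D S V α q⟩ : TangentBundle 𝓘(ℝ, E) Q)) := by
      simp only [xiLDalpha_eq S V hD hα]
      exact S.contMDiff_anchor.comp (sharpSecD hD α hα).1.contMDiff
    -- An integral curve starts at the given q; its lift has two expressions for the velocity at
    -- time 0, and their equality forces the vertical correction to vanish.
    obtain ⟨γ, rfl, hγ⟩ := exists_isMIntegralCurveAt_of_contMDiffAt_boundaryless (t₀ := 0)
      ((hv q).of_le (by simp))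
    obtain ⟨ε, hε, hγ⟩ := isMIntegralCurveAt_iff'.1 hγ
    have h0 : (0 : ℝ) ∈ Metric.ball (0 : ℝ) ε := Metric.mem_ball_self hε
    have hJ : Metric.ball (0 : ℝ) ε ∈ 𝓝 (0 : ℝ) := Metric.ball_mem_nhds 0 hε
    have h1 := ((h _ γ Metric.isOpen_ball (convex_ball 0 ε).ordConnected hγ).2 0 h0).hasMFDerivAt hJ
    have h2 := (hasMFDerivWithinAt_sharpSec_comp S V hD hα hγ h0).hasMFDerivAt hJ
    have h3 := congrArg (fun L => L (1 : ℝ)) (hasMFDerivAt_unique h1 h2)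
    have h4 : xiLD D S V (sharpSec F D α (γ 0)) =
        mfderiv 𝓘(ℝ, E) (𝓘(ℝ, E).prod 𝓘(ℝ, F)) (sharpSec F D α) (γ 0)
          (S.anchor (γ 0) (sharpD D (α (γ 0)) : A (γ 0))) := by
      have h5 := fun x : TangentSpace (𝓘(ℝ, E).prod 𝓘(ℝ, F)) (sharpSec F D α (γ 0)) =>
        one_smul ℝ x
      exact (h5 _).symm.trans (h3.trans (h5 _))
    obtain ⟨y, -, hy, hya⟩ := exists_xiLD_sharp S hV hD hα hcocycle (γ 0)
    rw [h4, eq_comm, sub_eq_self] at hy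
    have hy0 : y = 0 := vlift_eq_zero_iff.1 hy
    rw [← hya a, hy0, inner_zero_left]
  · intro h J c _ _ hc
    refine ⟨fun t _ => (sharpD D (α (c t))).2, fun t ht => ?_⟩
    obtain ⟨y, hyD, hy, hya⟩ := exists_xiLD_sharp S hV hD hα hcocycle (c t)
    -- As y lies in D, it may be tested against itself.
    have hy0 : y = 0 := by
      have := hya ⟨y, hyD⟩
      rw [h] at this
      exact inner_self_eq_zero.1 this
    have h1 : vlift E F (sharpSec F D α (c t)) y = 0 := vlift_eq_zero_iff.2 hy0
    rw [hy, h1, sub_zero]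
    exact hasMFDerivWithinAt_sharpSec_comp S V hD hα hc ht

end IntegralCurves

/-! ### Functions with zero almost differential: (ii) ⇔ (iii) -/

section Constants

theorem contMDiff_mlieBracket {U W : ∀ q : Q, TangentSpace 𝓘(ℝ, E) q}
    (hU : ContMDiff 𝓘(ℝ, E) 𝓘(ℝ, E).tangent ∞
      (fun q => (⟨q, U q⟩ : TangentBundle 𝓘(ℝ, E) Q)))
    (hW : ContMDiff 𝓘(ℝ, E) 𝓘(ℝ, E).tangent ∞
      (fun q => (⟨q, W q⟩ : TangentBundle 𝓘(ℝ, E) Q))) :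
    ContMDiff 𝓘(ℝ, E) 𝓘(ℝ, E).tangent ∞
      (fun q => (⟨q, VectorField.mlieBracket 𝓘(ℝ, E) U W q⟩ : TangentBundle 𝓘(ℝ, E) Q)) := by
  have : IsManifold 𝓘(ℝ, E) (((⊤ : ℕ∞) : WithTop ℕ∞) + 1) Q := by
    simpa using (inferInstance : IsManifold 𝓘(ℝ, E) ∞ Q)
  have : IsManifold 𝓘(ℝ, E) (minSmoothness ℝ 2) Q := IsManifold.of_le (n := ∞) (by
    rw [minSmoothness_of_isRCLikeNormedField]
    exact ENat.LEInfty.out)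
  exact ContDiff.mlieBracket_vectorField (m := ⊤) (n := ⊤) hU hW (by simp)

/-- A function annihilated by two smooth vector fields is annihilated by their Lie bracket. -/
theorem mvfderiv_mlieBracket_eq_zero {f : Q → ℝ} (hf : ContMDiff 𝓘(ℝ, E) 𝓘(ℝ, ℝ) ∞ f)
    {X Y : ∀ q : Q, TangentSpace 𝓘(ℝ, E) q}
    (hX : ContMDiff 𝓘(ℝ, E) 𝓘(ℝ, E).tangent ∞
      (fun q => (⟨q, X q⟩ : TangentBundle 𝓘(ℝ, E) Q)))
    (hY : ContMDiff 𝓘(ℝ, E) 𝓘(ℝ, E).tangent ∞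
      (fun q => (⟨q, Y q⟩ : TangentBundle 𝓘(ℝ, E) Q)))
    (hfX : ∀ q, mvfderiv 𝓘(ℝ, E) f q (X q) = 0) (hfY : ∀ q, mvfderiv 𝓘(ℝ, E) f q (Y q) = 0)
    (q : Q) : mvfderiv 𝓘(ℝ, E) f q (VectorField.mlieBracket 𝓘(ℝ, E) X Y q) = 0 := by
  have hsm := @contMDiff_mlieBracket E _ _ _ Q _ _ _ _
  have hd : ∀ {U : ∀ q : Q, TangentSpace 𝓘(ℝ, E) q},
      ContMDiff 𝓘(ℝ, E) 𝓘(ℝ, E).tangent ∞ (fun q => (⟨q, U q⟩ : TangentBundle 𝓘(ℝ, E) Q)) →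
      ∀ q, MDifferentiableAt 𝓘(ℝ, E) 𝓘(ℝ, E).tangent
        (fun q => (⟨q, U q⟩ : TangentBundle 𝓘(ℝ, E) Q)) q := fun h => h.mdifferentiable (by simp)
  have hfd : MDifferentiable 𝓘(ℝ, E) 𝓘(ℝ, ℝ) f := hf.mdifferentiable (by simp)
  have hmul : ∀ {U W : ∀ q : Q, TangentSpace 𝓘(ℝ, E) q},
      (∀ q, mvfderiv 𝓘(ℝ, E) f q (U q) = 0) →
      ContMDiff 𝓘(ℝ, E) 𝓘(ℝ, E).tangent ∞ (fun q => (⟨q, W q⟩ : TangentBundle 𝓘(ℝ, E) Q)) →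
      VectorField.mlieBracket 𝓘(ℝ, E) U (f • W) = f • VectorField.mlieBracket 𝓘(ℝ, E) U W := by
    intro U W hU hW
    funext q
    rw [VectorField.mlieBracket_smul_right (hfd q) (hd hW q), hU, zero_smul, zero_add]
    rfl
  have hjac : ∀ {Z : ∀ q : Q, TangentSpace 𝓘(ℝ, E) q},
      ContMDiff 𝓘(ℝ, E) 𝓘(ℝ, E).tangent ∞ (fun q => (⟨q, Z q⟩ : TangentBundle 𝓘(ℝ, E) Q)) →
      VectorField.mlieBracket 𝓘(ℝ, E) X (VectorField.mlieBracket 𝓘(ℝ, E) Y Z) q =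
        VectorField.mlieBracket 𝓘(ℝ, E) (VectorField.mlieBracket 𝓘(ℝ, E) X Y) Z q +
        VectorField.mlieBracket 𝓘(ℝ, E) Y (VectorField.mlieBracket 𝓘(ℝ, E) X Z) q := by
    intro Z hZ
    have h2 : minSmoothness ℝ 2 ≤ ∞ := by
      rw [minSmoothness_of_isRCLikeNormedField]
      exact ENat.LEInfty.out
    have : IsManifold 𝓘(ℝ, E) (minSmoothness ℝ 3) Q :=
      IsManifold.of_le (n := ∞) (by
        rw [minSmoothness_of_isRCLikeNormedField]
        exact ENat.LEInfty.out)
    exact VectorField.leibniz_identity_mlieBracket_apply ((hX q).of_le h2) ((hY q).of_le h2)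
      ((hZ q).of_le h2)
  set W := VectorField.mlieBracket 𝓘(ℝ, E) X Y with hW
  have hWs := hsm hX hY
  -- Jacobi for X, Y and fW: f passes through brackets with X and Y, while [W, fW] adds the term
  -- (Wf)W. Comparison with f times Jacobi for X, Y, W gives (Wf)W = 0, so at q either Wf or W
  -- vanishes, and both suffice.
  have h1 := hjac (hf.smul_section hWs)
  rw [hmul hfY hWs, hmul hfX hWs, hmul hfX (hsm hY hWs), hmul hfY (hsm hX hWs),
    VectorField.mlieBracket_smul_right (hfd q) (hd hWs q)] at h1
  have h2 := hjac hWs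
  simp only [Pi.smul_apply'] at h1
  rw [h2, smul_add, ← hW, add_right_cancel_iff, right_eq_add] at h1
  rcases smul_eq_zero.1 h1 with h | h
  · exact h
  · rw [h, map_zero]

/-- A smooth function with vanishing differential on a connected manifold is constant. -/
theorem exists_eq_const_of_mvfderiv_eq_zero [ConnectedSpace Q] {f : Q → ℝ}
    (hf : ContMDiff 𝓘(ℝ, E) 𝓘(ℝ, ℝ) ∞ f)
    (h : ∀ q (v : TangentSpace 𝓘(ℝ, E) q), mvfderiv 𝓘(ℝ, E) f q v = 0) :
    ∃ C : ℝ, ∀ q, f q = C := by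
  have hloc : IsLocallyConstant f := by
    rw [IsLocallyConstant.iff_eventually_eq]
    intro q
    let φ := extChartAt 𝓘(ℝ, E) q
    have ho : IsOpen φ.target := isOpen_extChartAt_target q
    obtain ⟨r, hr, hrt⟩ := Metric.isOpen_iff.1 ho (φ q) (mem_extChartAt_target q)
    have hz : ∀ z ∈ Metric.ball (φ q) r, HasFDerivAt (f ∘ φ.symm) (0 : E →L[ℝ] ℝ) z := by
      intro z hz
      have h1 : MDifferentiableAt 𝓘(ℝ, E) 𝓘(ℝ, E) φ.symm z :=
        ((contMDiffOn_extChartAt_symm (n := 1) q).contMDiffAt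
          (ho.mem_nhds (hrt hz))).mdifferentiableAt (by simp)
      have h2 := (hf.mdifferentiable (by simp) (φ.symm z)).hasMFDerivAt.comp z h1.hasMFDerivAt
      have h3 : (mfderiv 𝓘(ℝ, E) 𝓘(ℝ, ℝ) f (φ.symm z)).comp (mfderiv 𝓘(ℝ, E) 𝓘(ℝ, E) φ.symm z) =
          0 := ContinuousLinearMap.ext fun v => h (φ.symm z) _
      rw [h3] at h2
      exact h2.hasFDerivAt
    have hev : ∀ᶠ q' in 𝓝 q, φ q' ∈ Metric.ball (φ q) r :=
      (continuousAt_extChartAt q).eventually (Metric.ball_mem_nhds _ hr)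
    filter_upwards [hev, extChartAt_source_mem_nhds (I := 𝓘(ℝ, E)) q] with q' h1 h2
    have h3 := (convex_ball (φ q) r).is_const_of_fderivWithin_eq_zero (𝕜 := ℝ)
      (fun z hz' => (hz z hz').differentiableAt.differentiableWithinAt)
      (fun z hz' => by
        rw [fderivWithin_of_isOpen Metric.isOpen_ball hz']
        exact (hz z hz').fderiv) h1 (Metric.mem_ball_self hr)
    simp only [Function.comp_apply] at h3
    rwa [φ.left_inv h2, φ.left_inv (mem_extChartAt_source q)] at h3
  obtain ⟨q₀⟩ := (inferInstance : Nonempty Q)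
  exact ⟨f q₀, fun q => hloc.apply_eq_of_preconnectedSpace q q₀⟩

variable [IsContMDiffRiemannianBundle 𝓘(ℝ, E) ∞ F A] {D : ∀ q, Submodule ℝ (A q)}

/-- Smoothness is carried through the induction because the bracket step requires it. -/
theorem LieHull.contMDiff_and_mvfderiv_eq_zero (S : LieAlgebroid E F A) {f : Q → ℝ}
    (hf : ContMDiff 𝓘(ℝ, E) 𝓘(ℝ, ℝ) ∞ f) (h : ∀ q a, dFun D S f q a = 0)
    {X : ∀ q : Q, TangentSpace 𝓘(ℝ, E) q} (hX : LieHull (tangentFields D S) X) :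
    ContMDiff 𝓘(ℝ, E) 𝓘(ℝ, E).tangent ∞ (fun q => (⟨q, X q⟩ : TangentBundle 𝓘(ℝ, E) Q)) ∧
      ∀ q, mvfderiv 𝓘(ℝ, E) f q (X q) = 0 := by
  induction hX with
  | of X hX =>
    refine ⟨hX.1, fun q => ?_⟩
    obtain ⟨a, ha⟩ := hX.2 q
    rw [← ha]
    exact h q a
  | add X Y _ _ hX hY =>
    refine ⟨hX.1.add_section hY.1, fun q => ?_⟩
    rw [Pi.add_apply, map_add, hX.2, hY.2, add_zero]
  | smul c X _ hX =>
    refine ⟨hX.1.const_smul_section, fun q => ?_⟩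
    rw [Pi.smul_apply, map_smul, hX.2, smul_zero]
  | lie X Y _ _ hX hY =>
    exact ⟨contMDiff_mlieBracket hX.1 hY.1, mvfderiv_mlieBracket_eq_zero hf hX.1 hY.1 hX.2 hY.2⟩

theorem exists_eq_const_of_completelyNonholonomic [ConnectedSpace Q] (S : LieAlgebroid E F A)
    (hS : CompletelyNonholonomic D S) {f : Q → ℝ} (hf : ContMDiff 𝓘(ℝ, E) 𝓘(ℝ, ℝ) ∞ f)
    (h : ∀ q a, dFun D S f q a = 0) : ∃ C : ℝ, ∀ q, f q = C := by
  refine exists_eq_const_of_mvfderiv_eq_zero hf fun q v => ?_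
  obtain ⟨X, hX, rfl⟩ := hS q v
  exact (hX.contMDiff_and_mvfderiv_eq_zero S hf h).2 q

theorem dFun_const (S : LieAlgebroid E F A) (C : ℝ) (q : Q) (a : D q) :
    dFun D S (fun _ => C) q a = 0 := by
  rw [dFun, mvfderiv_const]
  rfl

/-- The constant 1 is a nonzero element of a one-dimensional space, so every element is a multiple
of it. -/
theorem exists_eq_const_of_H0_equiv (S : LieAlgebroid E F A) (e : H0 D S ≃ₗ[ℝ] ℝ) {f : Q → ℝ}
    (hf : ContMDiff 𝓘(ℝ, E) 𝓘(ℝ, ℝ) ∞ f) (h : ∀ q a, dFun D S f q a = 0) :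
    ∃ C : ℝ, ∀ q, f q = C := by
  rcases isEmpty_or_nonempty Q with hQ | ⟨⟨q₀⟩⟩
  · exact ⟨0, fun q => hQ.elim q⟩
  let f' : H0 D S := ⟨⟨f, hf⟩, h⟩
  let u : H0 D S := ⟨⟨fun _ => 1, contMDiff_const⟩, dFun_const S 1⟩
  have hu : e u ≠ 0 := fun h0 => by
    have h1 : u = 0 := e.map_eq_zero_iff.1 h0
    have h2 := congrArg (fun g : H0 D S => (g : C^∞⟮𝓘(ℝ, E), Q; 𝓘(ℝ, ℝ), ℝ⟯) q₀) h1
    exact one_ne_zero h2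
  have hfu : f' = (e f' / e u) • u := e.injective (by
    rw [map_smul, smul_eq_mul, div_mul_cancel₀ _ hu])
  refine ⟨e f' / e u, fun q => ?_⟩
  have h2 := congrArg (fun g : H0 D S => (g : C^∞⟮𝓘(ℝ, E), Q; 𝓘(ℝ, ℝ), ℝ⟯) q) hfu
  exact h2.trans (mul_one _)

end Constants

end NonholonomicHJ

end

open NonholonomicHJ in
theorem mainTheorem10
    {E : Type*} [NormedAddCommGroup E] [NormedSpace ℝ E] [FiniteDimensional ℝ E]
    {Q : Type*} [TopologicalSpace Q] [ChartedSpace E Q] [IsManifold 𝓘(ℝ, E) ∞ Q] [T2Space Q]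
    {F : Type*} [NormedAddCommGroup F] [NormedSpace ℝ F] [FiniteDimensional ℝ F]
    {A : Q → Type*} [TopologicalSpace (TotalSpace F A)] [∀ q, NormedAddCommGroup (A q)]
    [∀ q, InnerProductSpace ℝ (A q)] [∀ q, FiniteDimensional ℝ (A q)]
    [FiberBundle F A] [VectorBundle ℝ F A] [ContMDiffVectorBundle ∞ F A 𝓘(ℝ, E)]
    [IsContMDiffRiemannianBundle 𝓘(ℝ, E) ∞ F A]
    (S : LieAlgebroid E F A)
    (V : Q → ℝ) (hV : ContMDiff 𝓘(ℝ, E) 𝓘(ℝ, ℝ) ∞ V)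
    {k : ℕ} (D : ∀ q, Submodule ℝ (A q)) (hD : IsSubbundle E F k D)
    (α : ∀ q, Dual ℝ (D q)) (hα : IsSmoothDualSec E F D α)
    (hcocycle : ∀ (X Y : SecD E F D) (q : Q), dForm D S α X Y q = 0) :
    (LiftsIntegralCurves D S V α ↔ ∀ q a, dFun D S (energyAlong F D V α) q a = 0) ∧
    (Nonempty (H0 D S ≃ₗ[ℝ] ℝ) ∨ (CompletelyNonholonomic D S ∧ ConnectedSpace Q) →
      ((LiftsIntegralCurves D S V α ↔ ∃ C : ℝ, ∀ q, energyAlong F D V α q = C) ∧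
        ((∀ q a, dFun D S (energyAlong F D V α) q a = 0) ↔
          ∃ C : ℝ, ∀ q, energyAlong F D V α q = C))) := by
  have hlift := liftsIntegralCurves_iff S hV hD hα hcocycle
  refine ⟨hlift, fun h => ?_⟩
  have hconst : (∀ q a, dFun D S (energyAlong F D V α) q a = 0) ↔
      ∃ C : ℝ, ∀ q, energyAlong F D V α q = C := by
    constructor
    · intro h0
      have hs := contMDiff_energyAlong hV hD hα
      rcases h with ⟨⟨e⟩⟩ | ⟨hS, _⟩
      · exact exists_eq_const_of_H0_equiv S e hs h0
      · exact exists_eq_const_of_completelyNonholonomic S hS hs h0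
    · rintro ⟨C, hC⟩ q a
      rw [funext hC]
      exact dFun_const S C q a
  exact ⟨hlift.trans hconst, hconst⟩
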